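/- Work over $k=\mathbb C$. A Yetter--Drinfel'd module $M$ over a finite group $G$ is a $G$-graded vector space $M=\bigoplus_{g\in G}M_g$ with a linear $G$-action such that $g.M_h=M_{ghg^{-1}}$; it is called indecomposable if its support $\{g: M_g\neq 0\}$ generates $G$. Its Nichols algebra $\mathcal B(M)$ is the quotient of the tensor algebra $T(M)$ by the largest homogeneous two-sided ideal in degrees $\ge 2$ that is stable under all skew derivations $\partial_k$ attached to a homogeneous basis $e_k\in M_{g_k}$, where $\partial_k(1)=0$, $\partial_k(e_l)=\delta_{kl}$, $\partial_k(xy)=\partial_k(x)\,(g_k.y)+x\,\partial_k(y)$. Its bosonization $k[G]\#\mathcal B(M)$ is the Hopf algebra with elements the sums of $b\#g$ ($b\in\mathcal B(M)$, $g\in G$), multiplication $(b\#g)(c\#h)=b\,(g.c)\#gh$, and comultiplication determined by $\Delta(g)=g\otimes g$ for $g\in G$ and $\Delta(v)=v\otimes 1+g\otimes v$ for $v\in M_g$. **Corollary.** Let $G$ be a finite group with $[G,G]\cong\mathbb Z_2$. Then there is a finite-dimensional indecomposable Yetter--Drinfel'd module $M$ over $G$ whose Nichols algebra $\mathcal B(M)$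 is finite-dimensional and whose bosonization $H=k[G]\#\mathcal B(M)$ is a finite-dimensional pointed Hopf algebra with coradical $k[G]$ that is indecomposable: $H$ is not a direct sum of two nonzero subcoalgebras, and it is link-indecomposable, i.e. the graph whose vertices are the group-like elements of $H$, with an edge between $x$ and $y$ whenever there is $a\in H$ with $\Delta(a)=a\otimes x+y\otimes a$ and $a\notin k(x-y)$, is connected. (Thus the question of Montgomery, whether $G$ is the group of group-like elements of such a Hopf algebra, has a positive answer for these groups.) -/

import Mathlib

open scoped TensorProduct

universe u

noncomputable section

/-! ### Yetter-Drinfel'd modules over a group -/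

/-- A Yetter-Drinfel'd module structure over the group `G` on the complex vector space `V`:
a linear `G`-action and a direct sum decomposition `V = ⨁ g, grade g` with
`g . V_h = V_{g h g⁻¹}`. -/
structure YDModule (G : Type*) [Group G] (V : Type*) [AddCommGroup V] [Module ℂ V] where
  /-- the action of `G` -/
  act : Representation ℂ G V
  /-- the homogeneous components -/
  grade : G → Submodule ℂ V
  grade_iSupIndep : iSupIndep grade
  grade_iSup : ⨆ g, grade g = ⊤
  act_grade : ∀ g h, (grade h).map (act g) = grade (g * h * g⁻¹)

namespace YDModule

variable {G : Type*} [Group G] {V : Type*} [AddCommGroup V] [Module ℂ V] (M : YDModule G V)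

/-- `M` is (link-)indecomposable: its support generates the whole group. -/
def IsIndecomposable : Prop :=
  Subgroup.closure {g : G | M.grade g ≠ ⊥} = ⊤

/-! ### The tensor algebra, its action of `G`, and its skew derivations -/

/-- The homogeneous component of degree `n` of the tensor algebra. -/
abbrev tdeg (V : Type*) [AddCommGroup V] [Module ℂ V] (n : ℕ) :
    Submodule ℂ (TensorAlgebra ℂ V) :=
  LinearMap.range (TensorAlgebra.ι ℂ (M := V)) ^ n

/-- The action of `g` on the tensor algebra by algebra homomorphisms. -/
def tact (g : G) : TensorAlgebra ℂ V →ₐ[ℂ] TensorAlgebra ℂ V :=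
  TensorAlgebra.lift ℂ (TensorAlgebra.ι ℂ ∘ₗ M.act g)

@[simp] lemma tact_ι (g : G) (v : V) :
    M.tact g (TensorAlgebra.ι ℂ v) = TensorAlgebra.ι ℂ (M.act g v) := by
  simp [tact]

lemma tact_one : M.tact 1 = AlgHom.id ℂ _ := by
  ext v; simp

lemma tact_mul (g h : G) : M.tact (g * h) = (M.tact g).comp (M.tact h) := by
  ext v; simp

lemma tact_mul_apply (g h : G) (x : TensorAlgebra ℂ V) :
    M.tact (g * h) x = M.tact g (M.tact h x) := by
  rw [tact_mul]; rfl

/-- `x ↦ (x, ∂ x; 0, g . x)`, the algebra homomorphism to `2 × 2`-matrices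
that encodes the skew derivation `∂` with `∂ v = f v` for `v` in `V`. -/
def skewMat (g : G) (f : Module.Dual ℂ V) :
    TensorAlgebra ℂ V →ₐ[ℂ] Matrix (Fin 2) (Fin 2) (TensorAlgebra ℂ V) :=
  TensorAlgebra.lift ℂ
    { toFun := fun v => !![TensorAlgebra.ι ℂ v, algebraMap ℂ _ (f v);
                           0, TensorAlgebra.ι ℂ (M.act g v)]
      map_add' := fun v w => by
        ext i j; fin_cases i <;> fin_cases j <;> simp
      map_smul' := fun c v => by
        ext i j; fin_cases i <;> fin_cases j <;> simp [Algebra.smul_def] }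

/-- The skew derivation `∂` of the tensor algebra attached to `g` and the linear form `f`:
`∂ 1 = 0`, `∂ v = f v` for `v` in `V`, and `∂ (x y) = ∂ x (g . y) + x ∂ y`
(see `skewDer_one`, `skewDer_ι`, `skewDer_mul`). -/
def skewDer (g : G) (f : Module.Dual ℂ V) (x : TensorAlgebra ℂ V) : TensorAlgebra ℂ V :=
  M.skewMat g f x 0 1

lemma skewMat_ι (g : G) (f : Module.Dual ℂ V) (v : V) :
    M.skewMat g f (TensorAlgebra.ι ℂ v) =
      !![TensorAlgebra.ι ℂ v, algebraMap ℂ _ (f v); 0, TensorAlgebra.ι ℂ (M.act g v)] := by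
  simp [skewMat]

lemma skewMat_entries (g : G) (f : Module.Dual ℂ V) (x : TensorAlgebra ℂ V) :
    M.skewMat g f x 0 0 = x ∧ M.skewMat g f x 1 0 = 0 ∧ M.skewMat g f x 1 1 = M.tact g x := by
  induction x using TensorAlgebra.induction with
  | algebraMap r => simp [Matrix.algebraMap_matrix_apply]
  | ι v => simp [skewMat_ι]
  | mul a b ha hb =>
    obtain ⟨a1, a2, a3⟩ := ha
    obtain ⟨b1, b2, b3⟩ := hb
    simp [Matrix.mul_apply, Fin.sum_univ_two, a1, a2, a3, b1, b2, b3]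
  | add a b ha hb =>
    obtain ⟨a1, a2, a3⟩ := ha
    obtain ⟨b1, b2, b3⟩ := hb
    simp [a1, a2, a3, b1, b2, b3]

lemma skewDer_one (g : G) (f : Module.Dual ℂ V) : M.skewDer g f 1 = 0 := by
  simp [skewDer]

lemma skewDer_algebraMap (g : G) (f : Module.Dual ℂ V) (c : ℂ) :
    M.skewDer g f (algebraMap ℂ _ c) = 0 := by
  simp [skewDer, Matrix.algebraMap_matrix_apply]

lemma skewDer_ι (g : G) (f : Module.Dual ℂ V) (v : V) :
    M.skewDer g f (TensorAlgebra.ι ℂ v) = algebraMap ℂ _ (f v) := by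
  simp [skewDer, skewMat_ι]

lemma skewDer_mul (g : G) (f : Module.Dual ℂ V) (x y : TensorAlgebra ℂ V) :
    M.skewDer g f (x * y) = M.skewDer g f x * M.tact g y + x * M.skewDer g f y := by
  obtain ⟨x1, x2, x3⟩ := M.skewMat_entries g f x
  obtain ⟨y1, y2, y3⟩ := M.skewMat_entries g f y
  simp [skewDer, Matrix.mul_apply, Fin.sum_univ_two, x1, y3, add_comm]

lemma skewDer_add (g : G) (f : Module.Dual ℂ V) (x y : TensorAlgebra ℂ V) :
    M.skewDer g f (x + y) = M.skewDer g f x + M.skewDer g f y := by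
  simp [skewDer]

lemma skewDer_zero (g : G) (f : Module.Dual ℂ V) : M.skewDer g f 0 = 0 := by
  simp [skewDer]

/-! ### The Nichols algebra -/

/-- The linear form `f` is supported on the homogeneous component of `g`: it vanishes on all the
other ones. The members of the dual basis of a homogeneous basis are of this kind, and
they span all such forms. -/
def SupportedAt (g : G) (f : Module.Dual ℂ V) : Prop :=
  ∀ h, h ≠ g → ∀ v ∈ M.grade h, f v = 0

/-- The ideals of the tensor algebra that compete in the definition of the Nichols algebra:
two-sided homogeneous ideals, contained in degrees at least two and stable under all the skew
derivations. -/
structure IsNicholsIdeal (I : Ideal (TensorAlgebra ℂ V)) : Prop where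
  isTwoSided : I.IsTwoSided
  isHomogeneous : I.IsHomogeneous (tdeg V)
  le_degree : I.restrictScalars ℂ ≤ ⨆ n : ℕ, ⨆ _ : 2 ≤ n, tdeg V n
  skewDer_mem : ∀ (g : G) (f : Module.Dual ℂ V), M.SupportedAt g f →
    ∀ x ∈ I, M.skewDer g f x ∈ I

/-- The largest ideal satisfying `IsNicholsIdeal` (see `nicholsIdeal_isGreatest`). -/
def nicholsIdeal : Ideal (TensorAlgebra ℂ V) := sSup {I | M.IsNicholsIdeal I}

lemma nicholsIdeal_induction {p : TensorAlgebra ℂ V → Prop} {x : TensorAlgebra ℂ V}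
    (hx : x ∈ M.nicholsIdeal) (mem : ∀ I, M.IsNicholsIdeal I → ∀ y ∈ I, p y) (zero : p 0)
    (add : ∀ y z, p y → p z → p (y + z)) : p x := by
  rw [nicholsIdeal, sSup_eq_iSup'] at hx
  exact Submodule.iSup_induction _ (motive := p) hx (fun I y hy => mem I.1 I.2 y hy) zero add

lemma mem_nicholsIdeal {I : Ideal (TensorAlgebra ℂ V)} (hI : M.IsNicholsIdeal I)
    {x : TensorAlgebra ℂ V} (hx : x ∈ I) : x ∈ M.nicholsIdeal :=
  Submodule.mem_sSup_of_mem (s := I) hI hx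

lemma nicholsIdeal_isNicholsIdeal : M.IsNicholsIdeal M.nicholsIdeal where
  isTwoSided := ⟨fun {a} b ha => by
    refine M.nicholsIdeal_induction (p := fun a => a * b ∈ M.nicholsIdeal) ha ?_ ?_ ?_
    · intro I hI x hx
      exact M.mem_nicholsIdeal hI (hI.isTwoSided.mul_mem_of_left b hx)
    · rw [zero_mul]; exact zero_mem _
    · intro x y hx hy
      rw [add_mul]; exact add_mem hx hy⟩
  isHomogeneous := by
    intro n x hx
    refine M.nicholsIdeal_induction
      (p := fun a => (DirectSum.decompose (tdeg V) a n : TensorAlgebra ℂ V) ∈ M.nicholsIdeal)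
      hx ?_ ?_ ?_
    · intro I hI x hx
      exact M.mem_nicholsIdeal hI (hI.isHomogeneous n hx)
    · rw [DirectSum.decompose_zero]; exact zero_mem _
    · intro x y hx hy
      rw [DirectSum.decompose_add]; exact add_mem hx hy
  le_degree := by
    intro x hx
    refine M.nicholsIdeal_induction
      (p := fun a => a ∈ ⨆ n : ℕ, ⨆ _ : 2 ≤ n, tdeg V n) hx ?_ ?_ ?_
    · intro I hI x hx
      exact hI.le_degree hx
    · exact zero_mem _
    · intro x y hx hy
      exact add_mem hx hy
  skewDer_mem g f hf x hx := by
    refine M.nicholsIdeal_induction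
      (p := fun a => M.skewDer g f a ∈ M.nicholsIdeal) hx ?_ ?_ ?_
    · intro I hI x hx
      exact M.mem_nicholsIdeal hI (hI.skewDer_mem g f hf x hx)
    · rw [skewDer_zero]; exact zero_mem _
    · intro x y hx hy
      rw [skewDer_add]; exact add_mem hx hy

lemma nicholsIdeal_isGreatest : IsGreatest {I | M.IsNicholsIdeal I} M.nicholsIdeal :=
  ⟨M.nicholsIdeal_isNicholsIdeal, fun _ hI => le_sSup hI⟩

instance : M.nicholsIdeal.IsTwoSided := M.nicholsIdeal_isNicholsIdeal.isTwoSided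

/-- The Nichols algebra of `M`. -/
def NicholsAlgebra : Type _ := TensorAlgebra ℂ V ⧸ M.nicholsIdeal

instance : Ring M.NicholsAlgebra := inferInstanceAs (Ring (TensorAlgebra ℂ V ⧸ M.nicholsIdeal))

instance : Algebra ℂ M.NicholsAlgebra :=
  inferInstanceAs (Algebra ℂ (TensorAlgebra ℂ V ⧸ M.nicholsIdeal))

/-- The projection from the tensor algebra. -/
def toNichols : TensorAlgebra ℂ V →ₐ[ℂ] M.NicholsAlgebra := Ideal.Quotient.mkₐ ℂ M.nicholsIdeal

/-- The embedding of `V` in degree one. -/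
def nι : V →ₗ[ℂ] M.NicholsAlgebra := M.toNichols.toLinearMap ∘ₗ TensorAlgebra.ι ℂ

lemma toNichols_surjective : Function.Surjective M.toNichols :=
  Ideal.Quotient.mkₐ_surjective ℂ M.nicholsIdeal

lemma toNichols_eq_zero {x : TensorAlgebra ℂ V} : M.toNichols x = 0 ↔ x ∈ M.nicholsIdeal :=
  Ideal.Quotient.eq_zero_iff_mem

/-! ### The action of `G` on the Nichols algebra -/

lemma tact_tdeg (g : G) (n : ℕ) {x : TensorAlgebra ℂ V} (hx : x ∈ tdeg V n) :
    M.tact g x ∈ tdeg V n := by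
  have h : (tdeg V n).map (M.tact g).toLinearMap ≤ tdeg V n := by
    rw [tdeg, Submodule.map_pow]
    refine pow_le_pow_left' ?_ n
    rintro _ ⟨_, ⟨v, rfl⟩, rfl⟩
    exact ⟨M.act g v, by simp⟩
  exact h ⟨x, hx, rfl⟩

lemma tact_skewDer (g h : G) (f : Module.Dual ℂ V) (x : TensorAlgebra ℂ V) :
    M.tact g (M.skewDer h f x) =
      M.skewDer (g * h * g⁻¹) (f ∘ₗ M.act g⁻¹) (M.tact g x) := by
  induction x using TensorAlgebra.induction with
  | algebraMap r => simp [skewDer_algebraMap]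
  | ι v => simp [skewDer_ι]
  | mul a b ha hb =>
    simp only [map_mul, skewDer_mul, map_add, ha, hb]
    rw [← tact_mul_apply, ← tact_mul_apply]
    simp
  | add a b ha hb => simp only [map_add, skewDer_add, ha, hb]

lemma supportedAt_conj {h : G} {f : Module.Dual ℂ V} (hf : M.SupportedAt h f) (g : G) :
    M.SupportedAt (g * h * g⁻¹) (f ∘ₗ M.act g⁻¹) := by
  intro k hk v hv
  refine hf (g⁻¹ * k * g) (fun e => hk (by rw [← e]; group)) _ ?_
  have := M.act_grade g⁻¹ k
  rw [inv_inv] at this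
  rw [← this]
  exact ⟨v, hv, rfl⟩

lemma comap_isNicholsIdeal (g : G) {I : Ideal (TensorAlgebra ℂ V)} (hI : M.IsNicholsIdeal I) :
    M.IsNicholsIdeal (I.comap (M.tact g)) where
  isTwoSided := ⟨fun {a} b ha => by
    rw [Ideal.mem_comap] at ha ⊢
    rw [map_mul]
    exact hI.isTwoSided.mul_mem_of_left _ ha⟩
  isHomogeneous := by
    intro n x hx
    rw [Ideal.mem_comap] at hx ⊢
    have key : ∀ y : TensorAlgebra ℂ V, M.tact g (DirectSum.decompose (tdeg V) y n) =
        DirectSum.decompose (tdeg V) (M.tact g y) n := by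
      intro y
      induction y using DirectSum.Decomposition.inductionOn (tdeg V) with
      | zero => simp
      | @homogeneous i m =>
        have hm := M.tact_tdeg g i m.2
        by_cases h : i = n
        · subst h
          rw [DirectSum.decompose_of_mem_same _ m.2, DirectSum.decompose_of_mem_same _ hm]
        · rw [DirectSum.decompose_of_mem_ne _ m.2 h, DirectSum.decompose_of_mem_ne _ hm h,
            map_zero]
      | add a b ha hb => simp [DirectSum.decompose_add, ha, hb]
    rw [key]
    exact hI.isHomogeneous n hx
  le_degree := by
    intro x hx
    have h1 : M.tact g x ∈ ⨆ n : ℕ, ⨆ _ : 2 ≤ n, tdeg V n := hI.le_degree hx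
    have h2 : (⨆ n : ℕ, ⨆ _ : 2 ≤ n, tdeg V n) ≤
        (⨆ n : ℕ, ⨆ _ : 2 ≤ n, tdeg V n).comap (M.tact g⁻¹).toLinearMap := by
      refine iSup₂_le fun n hn y hy => ?_
      exact Submodule.mem_iSup_of_mem n (Submodule.mem_iSup_of_mem hn (M.tact_tdeg g⁻¹ n hy))
    have h3 := h2 h1
    rw [Submodule.mem_comap, AlgHom.toLinearMap_apply, ← tact_mul_apply, inv_mul_cancel,
      tact_one] at h3
    exact h3
  skewDer_mem h f hf x hx := by
    rw [Ideal.mem_comap] at hx ⊢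
    rw [tact_skewDer]
    exact hI.skewDer_mem _ _ (M.supportedAt_conj hf g) _ hx

lemma tact_nicholsIdeal (g : G) {x : TensorAlgebra ℂ V} (hx : x ∈ M.nicholsIdeal) :
    M.tact g x ∈ M.nicholsIdeal := by
  have h := M.nicholsIdeal_isGreatest.2 (M.comap_isNicholsIdeal g⁻¹ M.nicholsIdeal_isNicholsIdeal)
  apply h
  rw [Ideal.mem_comap, ← tact_mul_apply, inv_mul_cancel, tact_one]
  exact hx

/-- The action of `g` on the Nichols algebra, induced from the tensor algebra. -/
def nact (g : G) : M.NicholsAlgebra →ₐ[ℂ] M.NicholsAlgebra :=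
  Ideal.Quotient.liftₐ M.nicholsIdeal (M.toNichols.comp (M.tact g))
    (fun _ ha => M.toNichols_eq_zero.2 (M.tact_nicholsIdeal g ha))

@[simp] lemma nact_toNichols (g : G) (x : TensorAlgebra ℂ V) :
    M.nact g (M.toNichols x) = M.toNichols (M.tact g x) := rfl

/-- `G` acts on the Nichols algebra by algebra automorphisms. -/
instance : MulSemiringAction G M.NicholsAlgebra where
  smul g := M.nact g
  one_smul b := by
    obtain ⟨x, rfl⟩ := M.toNichols_surjective b
    change M.nact 1 _ = _
    rw [nact_toNichols, tact_one]; rfl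
  mul_smul g h b := by
    obtain ⟨x, rfl⟩ := M.toNichols_surjective b
    change M.nact (g * h) _ = M.nact g (M.nact h _)
    simp only [nact_toNichols, tact_mul_apply]
  smul_zero g := map_zero (M.nact g)
  smul_add g := map_add (M.nact g)
  smul_one g := map_one (M.nact g)
  smul_mul g := map_mul (M.nact g)

lemma smul_def (g : G) (b : M.NicholsAlgebra) : g • b = M.nact g b := rfl

lemma smul_nι (g : G) (v : V) : g • M.nι v = M.nι (M.act g v) := by
  change M.nact g (M.toNichols (TensorAlgebra.ι ℂ v)) = M.toNichols (TensorAlgebra.ι ℂ _)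
  simp

instance : SMulCommClass G ℂ M.NicholsAlgebra where
  smul_comm g c b := map_smul (M.nact g) c b

/-! ### The bosonization -/

/-- The underlying algebra of the bosonization `ℂ[G] # B(M)`: the smash product of the
Nichols algebra with the group algebra, whose elements are sums of `b # g`, with
`(b # g) (c # h) = b (g . c) # g h`. -/
abbrev SmashProduct : Type _ := SkewMonoidAlgebra M.NicholsAlgebra G

/-- The element `g` of the smash product. -/
def grp (g : G) : M.SmashProduct := SkewMonoidAlgebra.single g 1

/-- The element `v` of the smash product. -/
def vec (v : V) : M.SmashProduct := SkewMonoidAlgebra.single 1 (M.nι v)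

/-- The Hopf algebra `H` is, through the isomorphism `e` of algebras, the bosonization
`ℂ[G] # B(M)`: elements of `G` are group-like, and
`Δ v = v ⊗ 1 + g ⊗ v` for all `v` homogeneous of degree `g`.
As `G` and `V` generate the smash product, this determines the Hopf algebra structure. -/
structure IsBosonization {H : Type*} [Ring H] [HopfAlgebra ℂ H] (e : M.SmashProduct ≃ₐ[ℂ] H) :
    Prop where
  comul_grp : ∀ g, Coalgebra.comul (R := ℂ) (e (M.grp g)) = e (M.grp g) ⊗ₜ[ℂ] e (M.grp g)
  counit_grp : ∀ g, Coalgebra.counit (R := ℂ) (e (M.grp g)) = 1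
  comul_vec : ∀ g, ∀ v ∈ M.grade g, Coalgebra.comul (R := ℂ) (e (M.vec v)) =
    e (M.vec v) ⊗ₜ[ℂ] 1 + e (M.grp g) ⊗ₜ[ℂ] e (M.vec v)
  counit_vec : ∀ v, Coalgebra.counit (R := ℂ) (e (M.vec v)) = 0

end YDModule

/-! ### Coradical, pointed and indecomposable coalgebras -/

section Coalg

variable {C : Type*} [AddCommGroup C] [Module ℂ C] [Coalgebra ℂ C]

/-- `D` is a subcoalgebra: `Δ D ⊆ D ⊗ D`. -/
def IsSubcoalgebra (D : Submodule ℂ C) : Prop :=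
  ∀ x ∈ D, Coalgebra.comul (R := ℂ) x ∈ LinearMap.range (TensorProduct.map D.subtype D.subtype)

/-- `D` is a simple subcoalgebra. -/
def IsSimpleSubcoalgebra (D : Submodule ℂ C) : Prop :=
  IsSubcoalgebra D ∧ D ≠ ⊥ ∧ ∀ E ≤ D, IsSubcoalgebra E → E = ⊥ ∨ E = D

variable (C)

/-- The coradical: the sum of all simple subcoalgebras. -/
def coradical : Submodule ℂ C := sSup {D | IsSimpleSubcoalgebra D}

/-- A coalgebra is pointed if all its simple subcoalgebras are one-dimensional. -/
def IsPointedCoalgebra : Prop :=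
  ∀ D : Submodule ℂ C, IsSimpleSubcoalgebra D → Module.finrank ℂ D = 1

/-- A nonzero coalgebra is indecomposable if it is not the direct sum of two nonzero
subcoalgebras. -/
def IsIndecomposableCoalgebra : Prop :=
  Nontrivial C ∧ ∀ D E : Submodule ℂ C, IsSubcoalgebra D → IsSubcoalgebra E → IsCompl D E →
    D = ⊥ ∨ E = ⊥

variable {C}

/-- The group-like elements `x` and `y` are linked by a nontrivial skew primitive element:
one which is not a multiple of `x - y`. -/
def Linked (x y : GroupLike ℂ C) : Prop :=
  ∃ a : C, Coalgebra.comul (R := ℂ) a = a ⊗ₜ[ℂ] x.val + y.val ⊗ₜ[ℂ] a ∧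
    a ∉ Submodule.span ℂ {x.val - y.val}

variable (C)

/-- A pointed coalgebra is link-indecomposable if the graph on its group-like elements with
the links as edges is connected. -/
def IsLinkIndecomposable : Prop :=
  Nonempty (GroupLike ℂ C) ∧ ∀ x y : GroupLike ℂ C, Relation.EqvGen Linked x y

end Coalg

end

/-!
The Nichols algebra constructed here has a diagonal braiding, although the degrees of its
generators need not commute: a Yetter-Drinfel'd module over `G` is chosen on which the commutator
subgroup `{1, z}` acts trivially, so that `G` acts through an abelian group and the braiding is
diagonalizable.

Generators `g i` of `G` are obtained by lifting a basis of the abelianization. Commutation of the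
`g i` is recorded by an alternating form with values in `{1, -1}` (`csign`). Replacing generators by
products with generators whose order divides theirs, as one normalizes an alternating form over
`𝔽₂`, makes every `g i` fail to commute with at most one other generator, while characters `χ i`
dual to the generators survive (`IsDualizable.exists_matchedOn`). Odd components of the abelianization lift to
central elements, so a noncentral `g i` has even order there and `χ i (g i) = -1` can be arranged;
for a central one `χ i (g i)` is some nontrivial root of unity (`exists_isMatchedFamily`).

The module `M` is the sum over `i` of the span of the conjugacy class of `g i`, on which `G` acts by
conjugation twisted by `χ i` (`IsMatchedFamily.ydModule`). If `g i` is noncentral, then the sum and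
the difference of the two basis vectors are eigenvectors. In the basis of eigenvectors the
generalized Dynkin diagram of the braiding consists of two copies of `A₂` at `-1` for every
noncommuting pair and an isolated vertex for every central generator. For such braidings the
relations `x ^ N = 0`, `x y = q y x` for unlinked vertices and `(x y - q y x) ^ 2 = 0` for linked
ones hold in the Nichols algebra, which makes it finite-dimensional
(`YDModule.IsDiagonal.finiteDimensional`).

The bialgebra structure exists for every `M`. The Nichols ideal is the set of elements of the
tensor algebra all of whose iterated skew derivatives have constant term zero
(`YDModule.mem_nicholsIdeal_iff`). The iterated skew derivatives are the coefficients of the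
comultiplication of the bosonization, hence the comultiplication kills the Nichols ideal
(`YDModule.tcomul_eq_zero`). For a finite-dimensional bialgebra generated by invertible group-like
and by skew primitive elements the Galois map is surjective, hence bijective, and this yields the
antipode. Finally, a longest word of skew derivations that does not kill a coefficient of an element turns it
into a nonzero constant, so that every nonzero subcoalgebra contains an element of `G`
(`YDModule.exists_grp_mem_of_isSubcoalgebra`). This gives pointedness, the coradical and the
group-like elements. A nonzero vector of degree `g` links `h` to `g h`, so the graph of links is
connected because the support of `M` generates `G`, and the links prevent a decomposition into
two subcoalgebras.
-/

open scoped commutatorElement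

noncomputable section

/-! ### The Nichols ideal as the common kernel of the iterated skew derivations -/

namespace YDModule

variable {G : Type*} [Group G] {V : Type*} [AddCommGroup V] [Module ℂ V] (M : YDModule G V)

/-- A degree `g` together with a linear form supported on the component of degree `g`: the
data to which a skew derivation is attached. -/
abbrev Letter : Type _ := {p : G × Module.Dual ℂ V // M.SupportedAt p.1 p.2}

/-- The skew derivation of the tensor algebra attached to a letter, as a linear map. -/
def der (l : M.Letter) : TensorAlgebra ℂ V →ₗ[ℂ] TensorAlgebra ℂ V where
  toFun := M.skewDer l.1.1 l.1.2
  map_add' := M.skewDer_add _ _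
  map_smul' c x := by simp [skewDer]

lemma der_apply (l : M.Letter) (x : TensorAlgebra ℂ V) :
    M.der l x = M.skewDer l.1.1 l.1.2 x := rfl

lemma der_mul (l : M.Letter) (x y : TensorAlgebra ℂ V) :
    M.der l (x * y) = M.der l x * M.tact l.1.1 y + x * M.der l y :=
  M.skewDer_mul _ _ _ _

/-- The iterated skew derivation along a word; the first letter acts first. -/
def derWord : List M.Letter → TensorAlgebra ℂ V →ₗ[ℂ] TensorAlgebra ℂ V
  | [] => LinearMap.id
  | l :: w => derWord w ∘ₗ M.der l

@[simp] lemma derWord_nil (x : TensorAlgebra ℂ V) : M.derWord [] x = x := rfl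

@[simp] lemma derWord_cons (l : M.Letter) (w : List M.Letter) (x : TensorAlgebra ℂ V) :
    M.derWord (l :: w) x = M.derWord w (M.der l x) := rfl

lemma derWord_append (w w' : List M.Letter) (x : TensorAlgebra ℂ V) :
    M.derWord (w ++ w') x = M.derWord w' (M.derWord w x) := by
  induction w generalizing x with
  | nil => rfl
  | cons l w ih => simp [ih]

/-- The augmentation of the tensor algebra. -/
abbrev aug : TensorAlgebra ℂ V →ₐ[ℂ] ℂ := TensorAlgebra.algebraMapInv

lemma aug_ι (v : V) : aug (TensorAlgebra.ι ℂ v) = 0 := by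
  simp [TensorAlgebra.algebraMapInv]

lemma aug_tact (g : G) (x : TensorAlgebra ℂ V) : aug (M.tact g x) = aug x := by
  have : aug.comp (M.tact g) = aug := by
    ext v; simp [TensorAlgebra.algebraMapInv]
  exact congr($this x)

lemma aug_tdeg_pos {n : ℕ} (hn : n ≠ 0) {x : TensorAlgebra ℂ V} (hx : x ∈ tdeg V n) :
    aug x = 0 := by
  obtain ⟨n, rfl⟩ := Nat.exists_eq_succ_of_ne_zero hn
  rw [tdeg, pow_succ] at hx
  induction hx using Submodule.mul_induction_on' with
  | mem_mul_mem a ha b hb =>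
    obtain ⟨v, rfl⟩ := hb
    rw [map_mul, aug_ι, mul_zero]
  | add a _ b _ ha hb => rw [map_add, ha, hb, add_zero]

lemma mem_tdeg_zero {x : TensorAlgebra ℂ V} (hx : x ∈ tdeg V 0) :
    x = algebraMap ℂ _ (aug x) := by
  rw [tdeg, pow_zero] at hx
  obtain ⟨c, rfl⟩ := Submodule.mem_one.1 hx
  simp [TensorAlgebra.algebraMapInv]

lemma algebraMap_mem_tdeg_zero (c : ℂ) :
    algebraMap ℂ (TensorAlgebra ℂ V) c ∈ tdeg V 0 := by
  rw [tdeg, pow_zero]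
  exact Submodule.mem_one.2 ⟨c, rfl⟩

lemma der_tdeg_zero (l : M.Letter) {x : TensorAlgebra ℂ V} (hx : x ∈ tdeg V 0) :
    M.der l x = 0 := by
  rw [mem_tdeg_zero hx]
  exact M.skewDer_algebraMap _ _ _

lemma der_tdeg_succ (l : M.Letter) {n : ℕ} {x : TensorAlgebra ℂ V} (hx : x ∈ tdeg V (n + 1)) :
    M.der l x ∈ tdeg V n := by
  induction n generalizing x with
  | zero =>
    rw [tdeg, zero_add, pow_one] at hx
    obtain ⟨v, rfl⟩ := hx
    rw [der_apply, skewDer_ι]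
    exact algebraMap_mem_tdeg_zero _
  | succ n ih =>
    rw [tdeg, pow_succ'] at hx
    induction hx using Submodule.mul_induction_on' with
    | mem_mul_mem a ha b hb =>
      obtain ⟨v, rfl⟩ := ha
      rw [der_mul, der_apply, skewDer_ι, ← Algebra.smul_def]
      refine add_mem (Submodule.smul_mem _ _ (M.tact_tdeg _ _ hb)) ?_
      rw [tdeg, pow_succ']
      exact Submodule.mul_mem_mul ⟨v, rfl⟩ (ih hb)
    | add a _ b _ ha hb => rw [map_add]; exact add_mem ha hb

/-- The homogeneous component of degree `n` of an element of the tensor algebra. -/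
abbrev comp (n : ℕ) (x : TensorAlgebra ℂ V) : TensorAlgebra ℂ V :=
  DirectSum.decompose (tdeg V) x n

lemma comp_mem (n : ℕ) (x : TensorAlgebra ℂ V) : comp n x ∈ tdeg V n :=
  (DirectSum.decompose (tdeg V) x n).2

lemma comp_add (n : ℕ) (x y : TensorAlgebra ℂ V) : comp n (x + y) = comp n x + comp n y := by
  simp [comp, DirectSum.decompose_add]

lemma der_comp_zero (l : M.Letter) (x : TensorAlgebra ℂ V) : M.der l (comp 0 x) = 0 :=
  M.der_tdeg_zero l (comp_mem 0 x)

lemma der_comp_succ (l : M.Letter) (n : ℕ) (x : TensorAlgebra ℂ V) :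
    M.der l (comp (n + 1) x) = comp n (M.der l x) := by
  induction x using DirectSum.Decomposition.inductionOn (tdeg V) with
  | zero => simp [comp]
  | @homogeneous i m =>
    obtain ⟨m, hm⟩ := m
    rcases i with _ | i
    · rw [comp, DirectSum.decompose_of_mem_ne _ hm (Nat.succ_ne_zero n).symm,
        M.der_tdeg_zero l hm]
      simp [comp]
    · have h := M.der_tdeg_succ l hm
      by_cases e : i = n
      · subst e
        rw [comp, comp, DirectSum.decompose_of_mem_same _ hm, DirectSum.decompose_of_mem_same _ h]
      · rw [comp, comp, DirectSum.decompose_of_mem_ne _ hm (by omega),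
          DirectSum.decompose_of_mem_ne _ h e, map_zero]
  | add a b ha hb => rw [comp_add, map_add, ha, hb, map_add, comp_add]

lemma aug_comp_zero (x : TensorAlgebra ℂ V) : aug (comp 0 x) = aug x := by
  classical
  conv_rhs => rw [← DirectSum.sum_support_decompose (tdeg V) x, map_sum]
  rw [Finset.sum_eq_single 0]
  · exact fun n _ hn => aug_tdeg_pos hn (comp_mem n x)
  · intro h
    rw [DFinsupp.notMem_support_iff] at h
    rw [h]; simp

/-- A word of length `n` only sees the component of degree `n`. -/
lemma aug_derWord_comp (w : List M.Letter) (n : ℕ) (x : TensorAlgebra ℂ V) :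
    aug (M.derWord w (comp n x)) = if w.length = n then aug (M.derWord w x) else 0 := by
  induction w generalizing n x with
  | nil =>
    rcases n with _ | n
    · simpa using aug_comp_zero x
    · simpa using aug_tdeg_pos (Nat.succ_ne_zero n) (comp_mem (n + 1) x)
  | cons l w ih =>
    rcases n with _ | n
    · simp [der_comp_zero]
    · simp [der_comp_succ, ih]

lemma derWord_one_of_ne_nil {w : List M.Letter} (hw : w ≠ []) (c : ℂ) :
    M.derWord w (algebraMap ℂ _ c) = 0 := by
  cases w with
  | nil => exact absurd rfl hw
  | cons l w => rw [derWord_cons, M.der_tdeg_zero l (algebraMap_mem_tdeg_zero c), map_zero]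

/-- All iterated skew derivatives of `x`, including `x` itself, have augmentation zero. -/
def Killed (x : TensorAlgebra ℂ V) : Prop := ∀ w, aug (M.derWord w x) = 0

variable {M}

lemma Killed.add {x y : TensorAlgebra ℂ V} (hx : M.Killed x) (hy : M.Killed y) :
    M.Killed (x + y) := fun w => by rw [map_add, map_add, hx w, hy w, add_zero]

lemma Killed.der {x : TensorAlgebra ℂ V} (hx : M.Killed x) (l : M.Letter) :
    M.Killed (M.der l x) := fun w => hx (l :: w)

lemma Killed.tact {x : TensorAlgebra ℂ V} (hx : M.Killed x) (g : G) : M.Killed (M.tact g x) := by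
  intro w
  induction w generalizing x with
  | nil => rw [derWord_nil, aug_tact]; exact hx []
  | cons l w ih =>
    -- the derivation `∂_l ∘ g` equals `g ∘ ∂_{l'}` for the conjugated letter `l'`
    have h1 := M.supportedAt_conj l.2 g⁻¹
    have h := M.tact_skewDer g (g⁻¹ * l.1.1 * g⁻¹⁻¹) (l.1.2 ∘ₗ M.act g⁻¹⁻¹) x
    have e1 : g * (g⁻¹ * l.1.1 * g⁻¹⁻¹) * g⁻¹ = l.1.1 := by group
    have e2 : (l.1.2 ∘ₗ M.act g⁻¹⁻¹) ∘ₗ M.act g⁻¹ = l.1.2 := by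
      ext v
      simp only [LinearMap.comp_apply, ← Module.End.mul_apply, ← map_mul]
      simp
    rw [e1, e2] at h
    rw [derWord_cons, der_apply, ← h]
    exact ih (hx.der ⟨(_, _), h1⟩)

lemma Killed.mul_left {x : TensorAlgebra ℂ V} (hx : M.Killed x) (a : TensorAlgebra ℂ V) :
    M.Killed (a * x) := by
  intro w
  induction w generalizing x a with
  | nil => rw [derWord_nil, map_mul, show aug x = 0 from hx [], mul_zero]
  | cons l w ih =>
    rw [derWord_cons, der_mul, map_add, map_add, ih (hx.tact _), ih (hx.der l), add_zero]

lemma Killed.mul_right {x : TensorAlgebra ℂ V} (hx : M.Killed x) (a : TensorAlgebra ℂ V) :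
    M.Killed (x * a) := by
  intro w
  induction w generalizing x a with
  | nil => rw [derWord_nil, map_mul, show aug x = 0 from hx [], zero_mul]
  | cons l w ih =>
    rw [derWord_cons, der_mul, map_add, map_add, ih (hx.der l), ih hx, add_zero]

lemma Killed.comp {x : TensorAlgebra ℂ V} (hx : M.Killed x) (n : ℕ) : M.Killed (comp n x) := by
  intro w
  rw [aug_derWord_comp, hx w, ite_self]

variable (M)

/-- Linear maps out of a Yetter-Drinfel'd module can be prescribed on the components. -/
lemma exists_linearMap_of_grade {W : Type*} [AddCommGroup W] [Module ℂ W]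
    (φ : G → V →ₗ[ℂ] W) : ∃ L : V →ₗ[ℂ] W, ∀ g, ∀ v ∈ M.grade g, L v = φ g v := by
  classical
  have hi : DirectSum.IsInternal M.grade :=
    (DirectSum.isInternal_submodule_iff_iSupIndep_and_iSup_eq_top _).2
      ⟨M.grade_iSupIndep, M.grade_iSup⟩
  let := hi.chooseDecomposition
  refine ⟨DirectSum.toModule ℂ G W (fun g => φ g ∘ₗ (M.grade g).subtype) ∘ₗ
    (DirectSum.decomposeLinearEquiv M.grade).toLinearMap, fun g v hv => ?_⟩
  simp only [LinearMap.comp_apply, LinearEquiv.coe_coe, DirectSum.decomposeLinearEquiv_apply]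
  rw [DirectSum.decompose_of_mem _ hv]
  erw [DirectSum.toModule_lof]
  rfl

lemma grade_induction {p : V → Prop} (mem : ∀ g, ∀ v ∈ M.grade g, p v) (zero : p 0)
    (add : ∀ v w, p v → p w → p (v + w)) (v : V) : p v :=
  Submodule.iSup_induction M.grade (motive := p) (by rw [M.grade_iSup]; trivial) mem zero add

/-- The supported linear forms separate the points of `V`. -/
lemma eq_zero_of_supportedAt {v : V} (h : ∀ l : M.Letter, l.1.2 v = 0) : v = 0 := by
  classical
  -- the map sending `v` to the family of its homogeneous components
  obtain ⟨L, hL⟩ := M.exists_linearMap_of_grade (fun g => Finsupp.lsingle (R := ℂ) (M := V) g)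
  have hsum : ∀ v, (L v).sum (fun _ w => w) = v := fun v => by
    refine M.grade_induction (p := fun v => (L v).sum (fun _ w => w) = v) ?_ ?_ ?_ v
    · intro g v hv
      rw [hL g v hv, Finsupp.lsingle_apply, Finsupp.sum_single_index rfl]
    · simp
    · intro v w hv hw
      rw [map_add, Finsupp.sum_add_index' (fun _ => rfl) (fun _ _ _ => rfl), hv, hw]
  have hz : L v = 0 := by
    ext g
    refine (Module.forall_dual_apply_eq_zero_iff ℂ _).1 fun f => ?_
    refine h ⟨(g, f ∘ₗ Finsupp.lapply g ∘ₗ L), fun k hk w hw => ?_⟩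
    simp [hL k w hw, hk]
  rw [← hsum v, hz, Finsupp.sum_zero_index]

lemma killed_isNicholsIdeal : M.IsNicholsIdeal
    { carrier := {x | M.Killed x}
      add_mem' := Killed.add
      zero_mem' := fun w => by simp
      smul_mem' := fun a _ hx => hx.mul_left a } where
  isTwoSided := ⟨fun b ha => Killed.mul_right ha b⟩
  isHomogeneous n x hx := Killed.comp hx n
  skewDer_mem g f hf x hx := Killed.der hx ⟨(g, f), hf⟩
  le_degree := by
    classical
    intro x (hx : M.Killed x)
    have h0 : comp 0 x = 0 := by
      rw [mem_tdeg_zero (comp_mem 0 x), show aug (comp 0 x) = 0 from hx.comp 0 [], map_zero]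
    have h1 : comp 1 x = 0 := by
      have hm := comp_mem 1 x
      rw [tdeg, pow_one] at hm
      obtain ⟨v, hv⟩ := hm
      have : v = 0 := M.eq_zero_of_supportedAt fun l => by
        have := hx.comp 1 [l]
        rw [← hv, derWord_cons, derWord_nil, der_apply, skewDer_ι] at this
        simpa [TensorAlgebra.algebraMapInv] using this
      rw [← hv, this, map_zero]
    rw [← DirectSum.sum_support_decompose (tdeg V) x]
    refine sum_mem fun n _ => ?_
    rcases n with _ | _ | n
    · exact (congrArg (· ∈ _) h0).mpr (zero_mem _)
    · exact (congrArg (· ∈ _) h1).mpr (zero_mem _)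
    · exact Submodule.mem_iSup_of_mem (n + 2) (Submodule.mem_iSup_of_mem (by omega)
        (comp_mem (n + 2) x))

lemma aug_eq_zero_of_mem_nicholsIdeal {x : TensorAlgebra ℂ V} (hx : x ∈ M.nicholsIdeal) :
    aug x = 0 := by
  have h : (⨆ n : ℕ, ⨆ _ : 2 ≤ n, tdeg V n) ≤ LinearMap.ker (aug (V := V)).toLinearMap :=
    iSup₂_le fun n hn y hy => aug_tdeg_pos (by omega) hy
  exact h (M.nicholsIdeal_isNicholsIdeal.le_degree hx)

lemma derWord_mem_nicholsIdeal (w : List M.Letter) {x : TensorAlgebra ℂ V}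
    (hx : x ∈ M.nicholsIdeal) : M.derWord w x ∈ M.nicholsIdeal := by
  induction w generalizing x with
  | nil => exact hx
  | cons l w ih => exact ih (M.nicholsIdeal_isNicholsIdeal.skewDer_mem _ _ l.2 _ hx)

/-- The Nichols ideal consists of the elements all of whose iterated skew derivatives have
augmentation zero. Being defined by vanishing conditions, this description makes membership
checkable without generating ideals. -/
lemma mem_nicholsIdeal_iff {x : TensorAlgebra ℂ V} : x ∈ M.nicholsIdeal ↔ M.Killed x :=
  ⟨fun hx w => M.aug_eq_zero_of_mem_nicholsIdeal (M.derWord_mem_nicholsIdeal w hx),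
    fun hx => M.mem_nicholsIdeal M.killed_isNicholsIdeal hx⟩

/-- An element of the tensor algebra whose skew derivatives all lie in the Nichols ideal is
a constant modulo the Nichols ideal. -/
lemma sub_aug_mem_nicholsIdeal {x : TensorAlgebra ℂ V}
    (h : ∀ l : M.Letter, M.der l x ∈ M.nicholsIdeal) :
    x - algebraMap ℂ _ (aug x) ∈ M.nicholsIdeal := by
  rw [mem_nicholsIdeal_iff]
  rintro (_ | ⟨l, w⟩)
  · simp [TensorAlgebra.algebraMapInv]
  · rw [map_sub, M.derWord_one_of_ne_nil (List.cons_ne_nil l w), sub_zero]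
    exact M.mem_nicholsIdeal_iff.1 (h l) w

/-! ### Skew derivations of the Nichols algebra -/

/-- The augmentation of the Nichols algebra. -/
def naug : M.NicholsAlgebra →ₐ[ℂ] ℂ :=
  Ideal.Quotient.liftₐ M.nicholsIdeal aug fun _ ha => M.aug_eq_zero_of_mem_nicholsIdeal ha

@[simp] lemma naug_toNichols (x : TensorAlgebra ℂ V) : M.naug (M.toNichols x) = aug x := rfl

/-- The algebra homomorphism from the Nichols algebra to `2 × 2`-matrices that encodes the
skew derivation attached to a letter. -/
def nskewMat (l : M.Letter) : M.NicholsAlgebra →ₐ[ℂ] Matrix (Fin 2) (Fin 2) M.NicholsAlgebra :=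
  Ideal.Quotient.liftₐ M.nicholsIdeal (M.toNichols.mapMatrix.comp (M.skewMat l.1.1 l.1.2))
    fun a ha => by
      obtain ⟨h1, h2, h3⟩ := M.skewMat_entries l.1.1 l.1.2 a
      ext i j
      fin_cases i <;> fin_cases j
      · simpa [h1] using M.toNichols_eq_zero.2 ha
      · exact M.toNichols_eq_zero.2 (M.nicholsIdeal_isNicholsIdeal.skewDer_mem _ _ l.2 _ ha)
      · simp [h2]
      · simpa [h3] using M.toNichols_eq_zero.2 (M.tact_nicholsIdeal l.1.1 ha)

/-- The skew derivation of the Nichols algebra attached to a letter. -/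
def nder (l : M.Letter) : M.NicholsAlgebra →ₗ[ℂ] M.NicholsAlgebra where
  toFun b := M.nskewMat l b 0 1
  map_add' := by simp
  map_smul' := by simp

@[simp] lemma nder_toNichols (l : M.Letter) (x : TensorAlgebra ℂ V) :
    M.nder l (M.toNichols x) = M.toNichols (M.der l x) := rfl

lemma nder_mul (l : M.Letter) (a b : M.NicholsAlgebra) :
    M.nder l (a * b) = M.nder l a * M.nact l.1.1 b + a * M.nder l b := by
  obtain ⟨x, rfl⟩ := M.toNichols_surjective a
  obtain ⟨y, rfl⟩ := M.toNichols_surjective b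
  rw [← map_mul, nder_toNichols, der_mul]
  simp

lemma nder_nι (l : M.Letter) (v : V) :
    M.nder l (M.nι v) = algebraMap ℂ _ (l.1.2 v) := by
  change M.nder l (M.toNichols (TensorAlgebra.ι ℂ v)) = _
  rw [nder_toNichols, der_apply, skewDer_ι, AlgHom.commutes]

lemma nder_one (l : M.Letter) : M.nder l 1 = 0 := by
  have : M.nder l (M.toNichols 1) = 0 := by
    rw [nder_toNichols, der_apply, skewDer_one, map_zero]
  rwa [map_one] at this

lemma nact_nι (g : G) (v : V) : M.nact g (M.nι v) = M.nι (M.act g v) := M.smul_nι g v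

lemma naug_nι (v : V) : M.naug (M.nι v) = 0 := aug_ι v

lemma naug_nact (g : G) (b : M.NicholsAlgebra) : M.naug (M.nact g b) = M.naug b := by
  obtain ⟨x, rfl⟩ := M.toNichols_surjective b
  simp [aug_tact]

/-- The iterated skew derivation of the Nichols algebra along a word. -/
def nderWord : List M.Letter → M.NicholsAlgebra →ₗ[ℂ] M.NicholsAlgebra
  | [] => LinearMap.id
  | l :: w => nderWord w ∘ₗ M.nder l

@[simp] lemma nderWord_toNichols (w : List M.Letter) (x : TensorAlgebra ℂ V) :
    M.nderWord w (M.toNichols x) = M.toNichols (M.derWord w x) := by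
  induction w generalizing x with
  | nil => rfl
  | cons l w ih => simp [nderWord, ih]

/-- An element of augmentation zero all of whose skew derivatives vanish is zero. -/
lemma eq_zero_of_nder_eq_zero {b : M.NicholsAlgebra} (h0 : M.naug b = 0)
    (h : ∀ l, M.nder l b = 0) : b = 0 := by
  obtain ⟨x, rfl⟩ := M.toNichols_surjective b
  have := M.toNichols_eq_zero.2 (M.sub_aug_mem_nicholsIdeal fun l => M.toNichols_eq_zero.1 (h l))
  rw [naug_toNichols] at h0
  simpa [h0] using this

lemma eq_zero_of_naug_nderWord {b : M.NicholsAlgebra} (h : ∀ w, M.naug (M.nderWord w b) = 0) :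
    b = 0 := by
  obtain ⟨x, rfl⟩ := M.toNichols_surjective b
  rw [toNichols_eq_zero, mem_nicholsIdeal_iff]
  intro w
  simpa using h w

/-- Every nonzero element is carried to a nonzero constant by some iterated skew derivation:
one along a longest word whose derivative has nonzero augmentation. -/
lemma exists_nderWord_eq_algebraMap {b : M.NicholsAlgebra} (hb : b ≠ 0) :
    ∃ w, ∃ c : ℂ, c ≠ 0 ∧ M.nderWord w b = algebraMap ℂ _ c := by
  classical
  obtain ⟨x, rfl⟩ := M.toNichols_surjective b
  have hx : ¬ M.Killed x := fun h => hb (M.toNichols_eq_zero.2 (M.mem_nicholsIdeal_iff.2 h))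
  obtain ⟨w₀, hw₀⟩ := not_forall.1 hx
  let P : ℕ → Prop := fun n => ∃ w : List M.Letter, w.length = n ∧ aug (M.derWord w x) ≠ 0
  have hP : ∀ n, P n → n ∈ (DirectSum.decompose (tdeg V) x).support := by
    rintro n ⟨w, rfl, hw⟩
    by_contra h
    rw [DFinsupp.notMem_support_iff] at h
    have := M.aug_derWord_comp w w.length x
    rw [if_pos rfl, comp, h] at this
    exact hw (by simpa using this.symm)
  have hbd : ∀ n, P n → n ≤ (DirectSum.decompose (tdeg V) x).support.sup id :=
    fun n hn => Finset.le_sup (f := id) (hP n hn)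
  obtain ⟨w, hw, hne⟩ : P (Nat.findGreatest P _) :=
    Nat.findGreatest_spec (hbd w₀.length ⟨w₀, rfl, hw₀⟩) ⟨w₀, rfl, hw₀⟩
  refine ⟨w, aug (M.derWord w x), hne, ?_⟩
  rw [nderWord_toNichols, ← sub_eq_zero, ← AlgHom.commutes M.toNichols, ← map_sub,
    toNichols_eq_zero, mem_nicholsIdeal_iff]
  rintro (_ | ⟨l, w'⟩)
  · simp [TensorAlgebra.algebraMapInv]
  · rw [map_sub, M.derWord_one_of_ne_nil (List.cons_ne_nil l w'), sub_zero, ← derWord_append]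
    by_contra h
    have hlen : P (w ++ l :: w').length := ⟨_, rfl, h⟩
    have := Nat.le_findGreatest (hbd _ hlen) hlen
    rw [List.length_append, List.length_cons] at this
    omega

end YDModule

/-! ### The comultiplication of the bosonization -/

/-- Elements of a tensor product of vector spaces are separated by the functionals of a
separating family on the second factor. -/
lemma TensorProduct.eq_zero_of_lTensor_eq_zero {A B : Type*} [AddCommGroup A] [Module ℂ A]
    [AddCommGroup B] [Module ℂ B] {κ : Type*} (φ : κ → B →ₗ[ℂ] ℂ)
    (hφ : ∀ b, (∀ k, φ k b = 0) → b = 0) (u : A ⊗[ℂ] B)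
    (hu : ∀ k, (φ k).lTensor A u = 0) : u = 0 := by
  classical
  let b := Module.Free.chooseBasis ℂ A
  apply (TensorProduct.equivFinsuppOfBasisLeft (N := B) b).injective
  rw [map_zero]
  ext i
  refine hφ _ fun k => ?_
  have key : ∀ u : A ⊗[ℂ] B, φ k (TensorProduct.equivFinsuppOfBasisLeft b u i) =
      TensorProduct.equivFinsuppOfBasisLeft b ((φ k).lTensor A u) i := by
    intro u
    induction u using TensorProduct.induction_on with
    | zero => simp
    | tmul x y => simp
    | add x y hx hy => simp only [map_add, Finsupp.add_apply, hx, hy]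
  rw [key, hu, map_zero, Finsupp.zero_apply]

namespace YDModule

variable {G : Type*} [Group G] {V : Type*} [AddCommGroup V] [Module ℂ V] (M : YDModule G V)

/-- The inclusion of the Nichols algebra into the smash product. -/
def inc : M.NicholsAlgebra →ₐ[ℂ] M.SmashProduct where
  __ := SkewMonoidAlgebra.singleOneRingHom
  commutes' c := by
    simp [SkewMonoidAlgebra.singleOneRingHom, SkewMonoidAlgebra.coe_algebraMap]

lemma inc_apply (b : M.NicholsAlgebra) : M.inc b = SkewMonoidAlgebra.single 1 b := rfl

lemma vec_eq (v : V) : M.vec v = M.inc (M.nι v) := rfl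

/-- The inclusion of the group into the smash product. -/
def grpHom : G →* M.SmashProduct := SkewMonoidAlgebra.of M.NicholsAlgebra G

lemma grp_mul (g h : G) : M.grp (g * h) = M.grp g * M.grp h := map_mul M.grpHom g h

lemma grp_one : M.grp 1 = 1 := map_one M.grpHom

lemma inc_mul_grp (b : M.NicholsAlgebra) (g : G) :
    M.inc b * M.grp g = SkewMonoidAlgebra.single g b := by
  simp [inc_apply, grp, SkewMonoidAlgebra.single_mul_single]

lemma grp_mul_inc (g : G) (b : M.NicholsAlgebra) :
    M.grp g * M.inc b = M.inc (M.nact g b) * M.grp g := by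
  rw [inc_mul_grp]
  simp [inc_apply, grp, SkewMonoidAlgebra.single_mul_single, smul_def]

lemma grp_mul_vec (g : G) (v : V) : M.grp g * M.vec v = M.vec (M.act g v) * M.grp g := by
  rw [vec_eq, grp_mul_inc, nact_nι, vec_eq]

lemma smash_induction {p : M.SmashProduct → Prop} (x : M.SmashProduct)
    (mem : ∀ b g, p (M.inc b * M.grp g)) (zero : p 0) (add : ∀ x y, p x → p y → p (x + y)) :
    p x :=
  SkewMonoidAlgebra.induction_on x zero (fun g b => by rw [← inc_mul_grp]; exact mem b g)
    (fun {x y} => add x y)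

lemma nichols_induction {p : M.NicholsAlgebra → Prop} (b : M.NicholsAlgebra)
    (scalar : ∀ c, p (algebraMap ℂ _ c)) (nι : ∀ g, ∀ v ∈ M.grade g, p (M.nι v))
    (mul : ∀ a b, p a → p b → p (a * b)) (add : ∀ a b, p a → p b → p (a + b)) : p b := by
  obtain ⟨x, rfl⟩ := M.toNichols_surjective b
  induction x using TensorAlgebra.induction with
  | algebraMap r => rw [AlgHom.commutes]; exact scalar r
  | ι v =>
    refine M.grade_induction (p := fun v => p (M.toNichols (TensorAlgebra.ι ℂ v))) nι ?_ ?_ v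
    · rw [map_zero, map_zero, ← map_zero (algebraMap ℂ _)]
      exact scalar 0
    · intro v w hv hw
      rw [map_add, map_add]
      exact add _ _ hv hw
  | mul a b ha hb => rw [map_mul]; exact mul _ _ ha hb
  | add a b ha hb => rw [map_add]; exact add _ _ ha hb

/-- Group elements and homogeneous vectors generate the smash product. -/
lemma smash_algHom_ext {A : Type*} [Ring A] [Algebra ℂ A] {φ ψ : M.SmashProduct →ₐ[ℂ] A}
    (hg : ∀ g, φ (M.grp g) = ψ (M.grp g))
    (hv : ∀ g, ∀ v ∈ M.grade g, φ (M.vec v) = ψ (M.vec v)) : φ = ψ := by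
  ext x
  refine M.smash_induction (p := fun x => φ x = ψ x) x (fun b g => ?_) (by simp) ?_
  · rw [map_mul, map_mul, hg]
    congr 1
    refine M.nichols_induction (p := fun b => φ (M.inc b) = ψ (M.inc b)) b ?_ hv ?_ ?_
    · intro c; simp only [AlgHom.commutes]
    · intro a b ha hb; rw [map_mul, map_mul, map_mul, ha, hb]
    · intro a b ha hb; rw [map_add, map_add, map_add, ha, hb]
  · intro x y hx hy; rw [map_add, map_add, hx, hy]

lemma exists_coactL : ∃ L : V →ₗ[ℂ] M.SmashProduct ⊗[ℂ] M.NicholsAlgebra,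
    ∀ g, ∀ v ∈ M.grade g, L v = M.vec v ⊗ₜ 1 + M.grp g ⊗ₜ M.nι v := by
  obtain ⟨L, hL⟩ := M.exists_linearMap_of_grade fun g =>
    (TensorProduct.mk ℂ M.SmashProduct M.NicholsAlgebra).flip 1 ∘ₗ M.inc.toLinearMap ∘ₗ M.nι +
      TensorProduct.mk ℂ M.SmashProduct M.NicholsAlgebra (M.grp g) ∘ₗ M.nι
  exact ⟨L, fun g v hv => by rw [hL g v hv]; rfl⟩

/-- The comultiplication of the bosonization, restricted to `V`. As the values on `V` show,
it takes values in the tensor product of the smash product and the Nichols algebra. -/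
def coactL : V →ₗ[ℂ] M.SmashProduct ⊗[ℂ] M.NicholsAlgebra := M.exists_coactL.choose

lemma coactL_apply {g : G} {v : V} (hv : v ∈ M.grade g) :
    M.coactL v = M.vec v ⊗ₜ 1 + M.grp g ⊗ₜ M.nι v := M.exists_coactL.choose_spec g v hv

/-- The comultiplication of the bosonization, pulled back to the tensor algebra. -/
def tcomul : TensorAlgebra ℂ V →ₐ[ℂ] M.SmashProduct ⊗[ℂ] M.NicholsAlgebra :=
  TensorAlgebra.lift ℂ M.coactL

lemma tcomul_ι {g : G} {v : V} (hv : v ∈ M.grade g) :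
    M.tcomul (TensorAlgebra.ι ℂ v) = M.vec v ⊗ₜ 1 + M.grp g ⊗ₜ M.nι v := by
  rw [tcomul, TensorAlgebra.lift_ι_apply, M.coactL_apply hv]

lemma tensorAlgebra_induction {p : TensorAlgebra ℂ V → Prop} (x : TensorAlgebra ℂ V)
    (scalar : ∀ c, p (algebraMap ℂ _ c)) (ι : ∀ g, ∀ v ∈ M.grade g, p (TensorAlgebra.ι ℂ v))
    (mul : ∀ a b, p a → p b → p (a * b)) (add : ∀ a b, p a → p b → p (a + b)) : p x := by
  induction x using TensorAlgebra.induction with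
  | algebraMap r => exact scalar r
  | ι v =>
    refine M.grade_induction (p := fun v => p (TensorAlgebra.ι ℂ v)) ι ?_ ?_ v
    · rw [map_zero, ← map_zero (algebraMap ℂ _)]
      exact scalar 0
    · intro v w hv hw
      rw [map_add]
      exact add _ _ hv hw
  | mul a b ha hb => exact mul _ _ ha hb
  | add a b ha hb => exact add _ _ ha hb

lemma act_mem_grade (g h : G) {v : V} (hv : v ∈ M.grade h) :
    M.act g v ∈ M.grade (g * h * g⁻¹) := by
  rw [← M.act_grade]
  exact ⟨v, hv, rfl⟩

/-- The action of `g` on the second tensor factor. -/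
abbrev actR (g : G) : M.SmashProduct ⊗[ℂ] M.NicholsAlgebra →ₐ[ℂ]
    M.SmashProduct ⊗[ℂ] M.NicholsAlgebra :=
  Algebra.TensorProduct.map (AlgHom.id ℂ _) (M.nact g)

lemma tcomul_tact (g : G) (x : TensorAlgebra ℂ V) :
    M.tcomul (M.tact g x) * (M.grp g ⊗ₜ 1) = (M.grp g ⊗ₜ 1) * M.actR g (M.tcomul x) := by
  refine M.tensorAlgebra_induction (p := fun x => M.tcomul (M.tact g x) * (M.grp g ⊗ₜ 1) =
    (M.grp g ⊗ₜ 1) * M.actR g (M.tcomul x)) x ?_ ?_ ?_ ?_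
  · intro c
    simp only [AlgHom.commutes]
    exact Algebra.commutes _ _
  · intro h v hv
    rw [tact_ι, M.tcomul_ι hv, M.tcomul_ι (M.act_mem_grade g h hv)]
    simp only [map_add, Algebra.TensorProduct.map_tmul, add_mul, mul_add,
      Algebra.TensorProduct.tmul_mul_tmul, map_one, one_mul, mul_one, AlgHom.id_apply,
      grp_mul_vec, nact_nι, ← grp_mul, inv_mul_cancel_right]
  · intro a b ha hb
    rw [map_mul, map_mul, mul_assoc, hb, ← mul_assoc, ha, map_mul, map_mul, mul_assoc]
  · intro a b ha hb
    rw [map_add, map_add, add_mul, ha, hb, map_add, map_add, mul_add]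

/-- The skew derivation on the second tensor factor. -/
abbrev derR (l : M.Letter) : M.SmashProduct ⊗[ℂ] M.NicholsAlgebra →ₗ[ℂ]
    M.SmashProduct ⊗[ℂ] M.NicholsAlgebra :=
  (M.nder l).lTensor M.SmashProduct

lemma derR_mul (l : M.Letter) (u v : M.SmashProduct ⊗[ℂ] M.NicholsAlgebra) :
    M.derR l (u * v) = M.derR l u * M.actR l.1.1 v + u * M.derR l v := by
  induction u using TensorProduct.induction_on with
  | zero => simp
  | add x y hx hy => rw [add_mul, map_add, hx, hy, map_add, add_mul, add_mul]; abel
  | tmul s a =>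
    induction v using TensorProduct.induction_on with
    | zero => simp
    | add x y hx hy => rw [mul_add, map_add, hx, hy, map_add, map_add, mul_add, mul_add]; abel
    | tmul t b =>
      simp [nder_mul, TensorProduct.tmul_add]

/-- The skew derivations are the components of bidegree `(*, 1)` of the comultiplication. -/
lemma derR_tcomul (l : M.Letter) (x : TensorAlgebra ℂ V) :
    M.derR l (M.tcomul x) = M.tcomul (M.der l x) * (M.grp l.1.1 ⊗ₜ 1) := by
  refine M.tensorAlgebra_induction (p := fun x =>
    M.derR l (M.tcomul x) = M.tcomul (M.der l x) * (M.grp l.1.1 ⊗ₜ 1)) x ?_ ?_ ?_ ?_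
  · intro c
    rw [AlgHom.commutes, M.der_tdeg_zero l (algebraMap_mem_tdeg_zero c), map_zero, zero_mul,
      Algebra.TensorProduct.algebraMap_apply, LinearMap.lTensor_tmul, nder_one,
      TensorProduct.tmul_zero]
  · intro g v hv
    rw [M.tcomul_ι hv, der_apply, skewDer_ι, AlgHom.commutes, map_add, LinearMap.lTensor_tmul,
      LinearMap.lTensor_tmul, nder_one, TensorProduct.tmul_zero, zero_add, nder_nι,
      ← Algebra.smul_def, Algebra.algebraMap_eq_smul_one, TensorProduct.tmul_smul]
    by_cases h : g = l.1.1
    · rw [h]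
    · rw [l.2 g h v hv, zero_smul, zero_smul]
  · intro a b ha hb
    rw [map_mul, derR_mul, ha, hb, der_mul, map_add, map_mul, map_mul, add_mul, mul_assoc,
      mul_assoc, mul_assoc, tcomul_tact]
  · intro a b ha hb
    rw [map_add, map_add, ha, hb, map_add, map_add, add_mul]

/-- The product of the degrees of the letters of a word, in reverse order. -/
def degWord : List M.Letter → G
  | [] => 1
  | l :: w => degWord w * l.1.1

lemma lTensor_mul_tmul_one (φ : M.NicholsAlgebra →ₗ[ℂ] M.NicholsAlgebra)
    (u : M.SmashProduct ⊗[ℂ] M.NicholsAlgebra) (s : M.SmashProduct) :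
    φ.lTensor M.SmashProduct (u * (s ⊗ₜ 1)) = φ.lTensor M.SmashProduct u * (s ⊗ₜ 1) := by
  induction u using TensorProduct.induction_on with
  | zero => simp
  | add x y hx hy => rw [add_mul, map_add, hx, hy, map_add, add_mul]
  | tmul t b => simp

lemma nderWord_lTensor_tcomul (w : List M.Letter) (x : TensorAlgebra ℂ V) :
    (M.nderWord w).lTensor M.SmashProduct (M.tcomul x) =
      M.tcomul (M.derWord w x) * (M.grp (M.degWord w) ⊗ₜ 1) := by
  induction w generalizing x with
  | nil =>
    rw [degWord, grp_one, ← Algebra.TensorProduct.one_def, mul_one]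
    simp [nderWord]
  | cons l w ih =>
    rw [nderWord, LinearMap.lTensor_comp, LinearMap.comp_apply, derR_tcomul,
      lTensor_mul_tmul_one, ih, derWord_cons, degWord, grp_mul, mul_assoc,
      Algebra.TensorProduct.tmul_mul_tmul, mul_one]

/-- The augmentation of the second tensor factor. -/
def augR : M.SmashProduct ⊗[ℂ] M.NicholsAlgebra →ₐ[ℂ] M.SmashProduct :=
  (Algebra.TensorProduct.rid ℂ ℂ M.SmashProduct).toAlgHom.comp
    (Algebra.TensorProduct.map (AlgHom.id ℂ _) M.naug)

@[simp] lemma augR_tmul (s : M.SmashProduct) (b : M.NicholsAlgebra) :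
    M.augR (s ⊗ₜ b) = M.naug b • s := by
  simp [augR]

lemma augR_tcomul (x : TensorAlgebra ℂ V) : M.augR (M.tcomul x) = M.inc (M.toNichols x) := by
  refine M.tensorAlgebra_induction (p := fun x => M.augR (M.tcomul x) =
    M.inc (M.toNichols x)) x ?_ ?_ ?_ ?_
  · intro c; simp only [AlgHom.commutes]
  · intro g v hv
    rw [M.tcomul_ι hv, map_add, augR_tmul, augR_tmul, map_one, one_smul, naug_nι, zero_smul,
      add_zero]
    rfl
  · intro a b ha hb; rw [map_mul, map_mul, ha, hb, map_mul, map_mul]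
  · intro a b ha hb; rw [map_add, map_add, ha, hb, map_add, map_add]

/-- The functional on the Nichols algebra that takes the constant term of the iterated skew
derivative along a word. -/
def wordForm (w : List M.Letter) : M.NicholsAlgebra →ₗ[ℂ] ℂ :=
  M.naug.toLinearMap ∘ₗ M.nderWord w

lemma wordForm_lTensor (w : List M.Letter) (u : M.SmashProduct ⊗[ℂ] M.NicholsAlgebra) :
    TensorProduct.rid ℂ _ ((M.wordForm w).lTensor M.SmashProduct u) =
      M.augR ((M.nderWord w).lTensor M.SmashProduct u) := by
  induction u using TensorProduct.induction_on with
  | zero => simp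
  | add x y hx hy => simp only [map_add, hx, hy]
  | tmul t b => simp [wordForm]

lemma wordForm_lTensor_tcomul (w : List M.Letter) (x : TensorAlgebra ℂ V) :
    TensorProduct.rid ℂ _ ((M.wordForm w).lTensor M.SmashProduct (M.tcomul x)) =
      M.inc (M.toNichols (M.derWord w x)) * M.grp (M.degWord w) := by
  rw [wordForm_lTensor, nderWord_lTensor_tcomul, map_mul, augR_tcomul, augR_tmul, map_one,
    one_smul]

/-- The Nichols ideal is killed by the comultiplication: pairing the second factor with the
functionals `wordForm`, which separate the Nichols algebra, turns the comultiplication of `x` into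
iterated skew derivatives of `x`. -/
lemma tcomul_eq_zero {x : TensorAlgebra ℂ V} (hx : x ∈ M.nicholsIdeal) : M.tcomul x = 0 := by
  refine TensorProduct.eq_zero_of_lTensor_eq_zero M.wordForm
    (fun b hb => M.eq_zero_of_naug_nderWord hb) _ fun w => ?_
  apply (TensorProduct.rid ℂ M.SmashProduct).injective
  rw [wordForm_lTensor_tcomul, M.toNichols_eq_zero.2 (M.derWord_mem_nicholsIdeal w hx), map_zero,
    zero_mul, map_zero]

/-- The comultiplication of the bosonization, restricted to the Nichols algebra. -/
def ncomul : M.NicholsAlgebra →ₐ[ℂ] M.SmashProduct ⊗[ℂ] M.NicholsAlgebra :=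
  Ideal.Quotient.liftₐ M.nicholsIdeal M.tcomul fun _ ha => M.tcomul_eq_zero ha

lemma ncomul_toNichols (x : TensorAlgebra ℂ V) : M.ncomul (M.toNichols x) = M.tcomul x := rfl

lemma ncomul_nι {g : G} {v : V} (hv : v ∈ M.grade g) :
    M.ncomul (M.nι v) = M.vec v ⊗ₜ 1 + M.grp g ⊗ₜ M.nι v := M.tcomul_ι hv

lemma wordForm_lTensor_ncomul (w : List M.Letter) (b : M.NicholsAlgebra) :
    TensorProduct.rid ℂ _ ((M.wordForm w).lTensor M.SmashProduct (M.ncomul b)) =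
      M.inc (M.nderWord w b) * M.grp (M.degWord w) := by
  obtain ⟨x, rfl⟩ := M.toNichols_surjective b
  rw [ncomul_toNichols, wordForm_lTensor_tcomul, nderWord_toNichols]

/-- The inclusion of the second tensor factor into the smash product. -/
abbrev incR : M.SmashProduct ⊗[ℂ] M.NicholsAlgebra →ₐ[ℂ] M.SmashProduct ⊗[ℂ] M.SmashProduct :=
  Algebra.TensorProduct.map (AlgHom.id ℂ _) M.inc

/-- The comultiplication on the group elements. -/
def grpDiag : G →* M.SmashProduct ⊗[ℂ] M.SmashProduct where
  toFun g := M.grp g ⊗ₜ M.grp g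
  map_one' := by rw [grp_one]; rfl
  map_mul' g h := by rw [grp_mul, Algebra.TensorProduct.tmul_mul_tmul]

lemma incR_actR (g : G) (u : M.SmashProduct ⊗[ℂ] M.NicholsAlgebra) :
    M.incR (M.actR g u) * (1 ⊗ₜ M.grp g) = (1 ⊗ₜ M.grp g) * M.incR u := by
  induction u using TensorProduct.induction_on with
  | zero => simp
  | add x y hx hy => simp only [map_add, add_mul, mul_add, hx, hy]
  | tmul t b => simp [grp_mul_inc]

lemma incR_ncomul_smul (g : G) (b : M.NicholsAlgebra) :
    M.incR (M.ncomul (g • b)) * M.grpDiag g = M.grpDiag g * M.incR (M.ncomul b) := by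
  obtain ⟨x, rfl⟩ := M.toNichols_surjective b
  have h : M.grpDiag g = M.incR (M.grp g ⊗ₜ 1) * (1 ⊗ₜ M.grp g) := by simp [grpDiag]
  have h' : M.grpDiag g = (1 ⊗ₜ M.grp g) * M.incR (M.grp g ⊗ₜ 1) := by simp [grpDiag]
  rw [smul_def, nact_toNichols, ncomul_toNichols, ncomul_toNichols, h, ← mul_assoc, ← map_mul,
    tcomul_tact, map_mul, mul_assoc, incR_actR, ← mul_assoc, ← h, h']

/-- The comultiplication of the bosonization. -/
def scomul : M.SmashProduct →ₐ[ℂ] M.SmashProduct ⊗[ℂ] M.SmashProduct :=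
  SkewMonoidAlgebra.liftNCAlgHom (M.incR.comp M.ncomul) M.grpDiag
    (fun {b g} => M.incR_ncomul_smul g b)

lemma scomul_single (b : M.NicholsAlgebra) (g : G) :
    M.scomul (SkewMonoidAlgebra.single g b) = M.incR (M.ncomul b) * (M.grp g ⊗ₜ M.grp g) :=
  SkewMonoidAlgebra.liftNC_single _ _ _ _

lemma scomul_grp (g : G) : M.scomul (M.grp g) = M.grp g ⊗ₜ M.grp g := by
  rw [grp, scomul_single, map_one, map_one, one_mul]; rfl

lemma scomul_vec {g : G} {v : V} (hv : v ∈ M.grade g) :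
    M.scomul (M.vec v) = M.vec v ⊗ₜ 1 + M.grp g ⊗ₜ M.vec v := by
  rw [vec, scomul_single, grp_one, ← Algebra.TensorProduct.one_def, mul_one, M.ncomul_nι hv]
  simp; rfl

/-- The counit of the bosonization. -/
def scounit : M.SmashProduct →ₐ[ℂ] ℂ :=
  SkewMonoidAlgebra.liftNCAlgHom M.naug 1 (fun {b g} => by
    rw [smul_def, naug_nact, MonoidHom.one_apply, one_mul, mul_one])

lemma scounit_single (b : M.NicholsAlgebra) (g : G) :
    M.scounit (SkewMonoidAlgebra.single g b) = M.naug b :=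
  (SkewMonoidAlgebra.liftNC_single _ _ _ _).trans (mul_one _)

lemma scounit_grp (g : G) : M.scounit (M.grp g) = 1 := by
  rw [grp, scounit_single, map_one]

lemma scounit_vec (v : V) : M.scounit (M.vec v) = 0 := by
  rw [vec, scounit_single, naug_nι]

/-- The bosonization as a bialgebra. -/
@[reducible] def bialgebra : Bialgebra ℂ M.SmashProduct :=
  Bialgebra.ofAlgHom M.scomul M.scounit
    (M.smash_algHom_ext (fun g => by simp [scomul_grp]) (fun g v hv => by
      simp [M.scomul_vec hv, scomul_grp, TensorProduct.add_tmul, TensorProduct.tmul_add,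
        Algebra.TensorProduct.one_def, add_assoc]))
    (M.smash_algHom_ext (fun g => by simp [scomul_grp, scounit_grp]) (fun g v hv => by
      simp [M.scomul_vec hv, scounit_grp, scounit_vec]))
    (M.smash_algHom_ext (fun g => by simp [scomul_grp, scounit_grp]) (fun g v hv => by
      simp [M.scomul_vec hv, scounit_vec]))

end YDModule

/-! ### The antipode -/

section Antipode

variable (A : Type*) [Ring A] [Bialgebra ℂ A]

/-- The Galois map `b ⊗ a ↦ (b ⊗ 1) Δ a` of a bialgebra. -/
def galoisMap : A ⊗[ℂ] A →ₗ[ℂ] A ⊗[ℂ] A :=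
  LinearMap.mul' ℂ (A ⊗[ℂ] A) ∘ₗ TensorProduct.map
    (Algebra.TensorProduct.includeLeft : A →ₐ[ℂ] A ⊗[ℂ] A).toLinearMap Coalgebra.comul

variable {A}

@[simp] lemma galoisMap_tmul (b a : A) :
    galoisMap A (b ⊗ₜ a) = (b ⊗ₜ 1) * Coalgebra.comul a := by
  simp [galoisMap]

lemma tmul_one_mul_mem_range_galoisMap (s : A) {u : A ⊗[ℂ] A}
    (hu : u ∈ LinearMap.range (galoisMap A)) :
    (s ⊗ₜ 1) * u ∈ LinearMap.range (galoisMap A) := by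
  obtain ⟨v, rfl⟩ := hu
  induction v using TensorProduct.induction_on with
  | zero => simp
  | add x y hx hy => rw [map_add, mul_add]; exact add_mem hx hy
  | tmul b a => exact ⟨(s * b) ⊗ₜ a, by simp [← mul_assoc]⟩

lemma mul_comul_mem_range_galoisMap (c : A) {u : A ⊗[ℂ] A}
    (hu : u ∈ LinearMap.range (galoisMap A)) :
    u * Coalgebra.comul c ∈ LinearMap.range (galoisMap A) := by
  obtain ⟨v, rfl⟩ := hu
  induction v using TensorProduct.induction_on with
  | zero => simp
  | add x y hx hy => rw [map_add, add_mul]; exact add_mem hx hy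
  | tmul b a => exact ⟨b ⊗ₜ (a * c), by simp [mul_assoc]⟩

/-- The elements `x` with `1 ⊗ x` in the image of the Galois map are closed under products. -/
lemma one_tmul_mul_mem_range_galoisMap {x y : A}
    (hx : (1 : A) ⊗ₜ[ℂ] x ∈ LinearMap.range (galoisMap A))
    (hy : (1 : A) ⊗ₜ[ℂ] y ∈ LinearMap.range (galoisMap A)) :
    (1 : A) ⊗ₜ[ℂ] (x * y) ∈ LinearMap.range (galoisMap A) := by
  have h : (1 : A) ⊗ₜ[ℂ] (x * y) = (1 ⊗ₜ x) * (1 ⊗ₜ y) := by simp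
  obtain ⟨v, hv⟩ := hy
  rw [h, ← hv]
  clear h hv
  induction v using TensorProduct.induction_on with
  | zero => simp
  | add x y hx hy => rw [map_add, mul_add]; exact add_mem hx hy
  | tmul d c =>
    have : (1 ⊗ₜ[ℂ] x) * (d ⊗ₜ[ℂ] 1) = (d ⊗ₜ[ℂ] (1 : A)) * ((1 : A) ⊗ₜ[ℂ] x) := by simp
    rw [galoisMap_tmul, ← mul_assoc, this, mul_assoc]
    exact tmul_one_mul_mem_range_galoisMap d (mul_comul_mem_range_galoisMap c hx)

lemma galoisMap_surjective (h : ∀ x, (1 : A) ⊗ₜ[ℂ] x ∈ LinearMap.range (galoisMap A)) :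
    Function.Surjective (galoisMap A) := by
  intro u
  change u ∈ LinearMap.range (galoisMap A)
  induction u using TensorProduct.induction_on with
  | zero => exact zero_mem _
  | add x y hx hy => exact add_mem hx hy
  | tmul s x =>
    have : s ⊗ₜ[ℂ] x = (s ⊗ₜ 1) * (1 ⊗ₜ x) := by simp
    rw [this]
    exact tmul_one_mul_mem_range_galoisMap s (h x)

open WithConv in
/-- A finite-dimensional bialgebra whose Galois map is surjective is a Hopf algebra: the
identity is then not a left zero divisor of the finite-dimensional convolution algebra,
so it has a convolution inverse. -/
lemma exists_convolution_inverse [FiniteDimensional ℂ A]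
    (h : Function.Surjective (galoisMap A)) :
    ∃ S : WithConv (A →ₗ[ℂ] A), S * toConv LinearMap.id = 1 ∧ toConv LinearMap.id * S = 1 := by
  have : FiniteDimensional ℂ (WithConv (A →ₗ[ℂ] A)) :=
    Module.Finite.equiv (WithConv.linearEquiv ℂ (A →ₗ[ℂ] A)).symm
  have h0 : ∀ f : WithConv (A →ₗ[ℂ] A), toConv LinearMap.id * f = 0 → f = 0 := by
    intro f hf
    have hmul : ∀ (b : A) (u : A ⊗[ℂ] A), LinearMap.mul' ℂ A
        (TensorProduct.map LinearMap.id f.ofConv ((b ⊗ₜ 1) * u)) =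
          b * LinearMap.mul' ℂ A (TensorProduct.map LinearMap.id f.ofConv u) := by
      intro b u
      induction u using TensorProduct.induction_on with
      | zero => simp
      | add x y hx hy => rw [mul_add, map_add, map_add, hx, hy, map_add, map_add, mul_add]
      | tmul x y => simp [mul_assoc]
    have hgal : ∀ u, LinearMap.mul' ℂ A
        (TensorProduct.map LinearMap.id f.ofConv (galoisMap A u)) = 0 := by
      intro u
      induction u using TensorProduct.induction_on with
      | zero => simp
      | add x y hx hy => rw [map_add, map_add, map_add, hx, hy, add_zero]
      | tmul b a =>
        have ha : LinearMap.mul' ℂ A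
            (TensorProduct.map LinearMap.id f.ofConv (Coalgebra.comul a)) = 0 :=
          congrArg (fun F : WithConv (A →ₗ[ℂ] A) => F.ofConv a) hf
        rw [galoisMap_tmul, hmul, ha, mul_zero]
    apply WithConv.ext
    ext y
    obtain ⟨u, hu⟩ := h (1 ⊗ₜ y)
    have := hgal u
    rw [hu] at this
    simpa using this
  have hinj : Function.Injective
      (LinearMap.mulLeft ℂ (toConv (LinearMap.id (R := ℂ) (M := A)))) :=
    (injective_iff_map_eq_zero _).2 h0
  obtain ⟨S, hS⟩ := LinearMap.injective_iff_surjective.1 hinj 1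
  rw [LinearMap.mulLeft_apply] at hS
  refine ⟨S, sub_eq_zero.1 (h0 _ ?_), hS⟩
  rw [mul_sub, ← mul_assoc, hS, one_mul, mul_one, sub_self]

end Antipode

namespace YDModule

variable {G : Type*} [Group G] {V : Type*} [AddCommGroup V] [Module ℂ V] (M : YDModule G V)

instance [Finite G] [FiniteDimensional ℂ M.NicholsAlgebra] :
    FiniteDimensional ℂ M.SmashProduct :=
  Module.Finite.equiv (SkewMonoidAlgebra.coeffLinearEquiv (S := ℂ) (k := M.NicholsAlgebra)
    (G := G)).symm

lemma galoisMap_smash_surjective : letI := M.bialgebra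
    Function.Surjective (galoisMap M.SmashProduct) := by
  let := M.bialgebra
  have hc : ∀ x, Coalgebra.comul (R := ℂ) x = M.scomul x := fun _ => rfl
  refine galoisMap_surjective fun x => ?_
  refine M.smash_induction (p := fun x => (1 : M.SmashProduct) ⊗ₜ[ℂ] x ∈
    LinearMap.range (galoisMap M.SmashProduct)) x ?_ ?_ ?_
  · intro b g
    refine one_tmul_mul_mem_range_galoisMap ?_ ?_
    · refine M.nichols_induction (p := fun b => (1 : M.SmashProduct) ⊗ₜ[ℂ] M.inc b ∈
        LinearMap.range (galoisMap M.SmashProduct)) b ?_ ?_ ?_ ?_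
      · intro c
        exact ⟨1 ⊗ₜ algebraMap ℂ _ c, by
          rw [galoisMap_tmul, hc, AlgHom.commutes, AlgHom.commutes,
            Algebra.algebraMap_eq_smul_one, Algebra.algebraMap_eq_smul_one]
          simp⟩
      · intro g v hv
        refine ⟨M.grp g⁻¹ ⊗ₜ M.vec v - (M.grp g⁻¹ * M.vec v) ⊗ₜ 1, ?_⟩
        rw [map_sub, galoisMap_tmul, galoisMap_tmul, hc, hc, M.scomul_vec hv, map_one, mul_add,
          mul_one, Algebra.TensorProduct.tmul_mul_tmul, Algebra.TensorProduct.tmul_mul_tmul,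
          ← grp_mul, inv_mul_cancel, grp_one, one_mul, one_mul, add_sub_cancel_left, vec_eq]
      · intro a b ha hb
        rw [map_mul]
        exact one_tmul_mul_mem_range_galoisMap ha hb
      · intro a b ha hb
        rw [map_add, TensorProduct.tmul_add]
        exact add_mem ha hb
    · exact ⟨M.grp g⁻¹ ⊗ₜ M.grp g, by
        rw [galoisMap_tmul, hc, scomul_grp, Algebra.TensorProduct.tmul_mul_tmul, ← grp_mul,
          inv_mul_cancel, grp_one, one_mul]⟩
  · rw [TensorProduct.tmul_zero]; exact zero_mem _
  · intro x y hx hy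
    rw [TensorProduct.tmul_add]
    exact add_mem hx hy

/-- The bosonization of a finite-dimensional Nichols algebra as a Hopf algebra. -/
@[reducible] def hopfAlgebra [FiniteDimensional ℂ M.SmashProduct] :
    HopfAlgebra ℂ M.SmashProduct :=
  letI := M.bialgebra
  let h := exists_convolution_inverse M.galoisMap_smash_surjective
  { M.bialgebra with
    antipode := h.choose.ofConv
    mul_antipode_rTensor_comul := congrArg WithConv.ofConv h.choose_spec.1
    mul_antipode_lTensor_comul := congrArg WithConv.ofConv h.choose_spec.2 }

lemma isBosonization_hopfAlgebra [FiniteDimensional ℂ M.SmashProduct] :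
    letI := M.hopfAlgebra
    M.IsBosonization (H := M.SmashProduct) AlgEquiv.refl :=
  letI := M.hopfAlgebra
  { comul_grp := M.scomul_grp
    counit_grp := M.scounit_grp
    comul_vec := fun _ _ hv => M.scomul_vec hv
    counit_vec := M.scounit_vec }

end YDModule

/-! ### Coalgebras in which every subcoalgebra contains a group-like element -/

section Coalg

variable {C : Type*} [AddCommGroup C] [Module ℂ C] [Coalgebra ℂ C]

lemma IsSubcoalgebra.rid_lTensor_comul_mem {D : Submodule ℂ C} (hD : IsSubcoalgebra D)
    (φ : C →ₗ[ℂ] ℂ) {x : C} (hx : x ∈ D) :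
    TensorProduct.rid ℂ C (φ.lTensor C (Coalgebra.comul x)) ∈ D := by
  obtain ⟨u, hu⟩ := hD x hx
  rw [← hu]
  clear hu
  induction u using TensorProduct.induction_on with
  | zero => simp
  | add a b ha hb => simp only [map_add]; exact add_mem ha hb
  | tmul a b => simpa using D.smul_mem _ a.2

lemma IsGroupLikeElem.isSubcoalgebra_span {x : C} (hx : IsGroupLikeElem ℂ x) :
    IsSubcoalgebra (Submodule.span ℂ {x}) := by
  intro y hy
  obtain ⟨c, rfl⟩ := Submodule.mem_span_singleton.1 hy
  let x' : Submodule.span ℂ {x} := ⟨x, Submodule.mem_span_singleton_self x⟩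
  exact ⟨c • (x' ⊗ₜ x'), by simp [x', hx.comul_eq_tmul_self]⟩

lemma IsGroupLikeElem.isSimpleSubcoalgebra_span {x : C} (hx : IsGroupLikeElem ℂ x) :
    IsSimpleSubcoalgebra (Submodule.span ℂ {x}) :=
  ⟨hx.isSubcoalgebra_span, by simpa using hx.ne_zero,
    fun _ hE _ => (nonzero_span_atom x hx.ne_zero).le_iff.1 hE⟩

variable (C) in
/-- Every nonzero subcoalgebra contains a group-like element. -/
def HasGroupLikes : Prop :=
  ∀ D : Submodule ℂ C, IsSubcoalgebra D → D ≠ ⊥ → ∃ x ∈ D, IsGroupLikeElem ℂ x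

lemma HasGroupLikes.eq_span (h : HasGroupLikes C) {D : Submodule ℂ C}
    (hD : IsSimpleSubcoalgebra D) : ∃ x, IsGroupLikeElem ℂ x ∧ D = Submodule.span ℂ {x} := by
  obtain ⟨x, hxD, hx⟩ := h D hD.1 hD.2.1
  refine ⟨x, hx, ?_⟩
  rcases hD.2.2 _ ((Submodule.span_singleton_le_iff_mem x D).2 hxD) hx.isSubcoalgebra_span with
    h | h
  · exact absurd h (by simpa using hx.ne_zero)
  · exact h.symm

lemma HasGroupLikes.isPointedCoalgebra (h : HasGroupLikes C) : IsPointedCoalgebra C := by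
  intro D hD
  obtain ⟨x, hx, rfl⟩ := h.eq_span hD
  exact finrank_span_singleton hx.ne_zero

lemma HasGroupLikes.coradical_eq (h : HasGroupLikes C) :
    coradical C = Submodule.span ℂ {x : C | IsGroupLikeElem ℂ x} := by
  apply le_antisymm
  · refine sSup_le fun D hD => ?_
    obtain ⟨x, hx, rfl⟩ := h.eq_span hD
    exact Submodule.span_mono (by simpa using hx)
  · rw [Submodule.span_le]
    intro x hx
    exact Submodule.mem_sSup_of_mem (IsGroupLikeElem.isSimpleSubcoalgebra_span hx)
      (Submodule.mem_span_singleton_self x)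

/-- Linear maps that restrict to scalars on a subcoalgebra act by the product of these scalars on
the comultiplications of its elements. -/
lemma map_comul_of_mem {D : Submodule ℂ C} (hD : IsSubcoalgebra D) {p q : C →ₗ[ℂ] C} {c d : ℂ}
    (hp : ∀ x ∈ D, p x = c • x) (hq : ∀ x ∈ D, q x = d • x) {x : C} (hx : x ∈ D) :
    TensorProduct.map p q (Coalgebra.comul x) = (c * d) • Coalgebra.comul (R := ℂ) x := by
  obtain ⟨u, hu⟩ := hD x hx
  rw [← hu]
  clear hu
  induction u using TensorProduct.induction_on with
  | zero => simp
  | add a b ha hb => simp only [map_add, smul_add, ha, hb]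
  | tmul a b => simp [hp, hq, TensorProduct.smul_tmul', smul_smul, mul_comm c d]

variable {D E : Submodule ℂ C}

/-- The projections of a direct sum of two subcoalgebras are compatible with the
comultiplication. -/
lemma exists_projections_of_isCompl (hD : IsSubcoalgebra D) (hE : IsSubcoalgebra E)
    (h : IsCompl D E) : ∃ p q : C →ₗ[ℂ] C,
      (∀ z, p z ∈ D) ∧ (∀ z, q z ∈ E) ∧ (∀ z, p z + q z = z) ∧
      (∀ z ∈ D, p z = z ∧ q z = 0) ∧ (∀ z ∈ E, p z = 0 ∧ q z = z) ∧
      ∀ z, TensorProduct.map p p (Coalgebra.comul z) = Coalgebra.comul (R := ℂ) (p z) ∧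
        TensorProduct.map q q (Coalgebra.comul z) = Coalgebra.comul (R := ℂ) (q z) ∧
        TensorProduct.map p q (Coalgebra.comul (R := ℂ) z) = 0 := by
  let p : C →ₗ[ℂ] C := D.subtype ∘ₗ D.projectionOnto E h
  let q : C →ₗ[ℂ] C := LinearMap.id - p
  have hpD : ∀ z ∈ D, p z = (1 : ℂ) • z := fun z hz => by
    rw [one_smul]
    exact congrArg Subtype.val (Submodule.projectionOnto_apply_left h ⟨z, hz⟩)
  have hpE : ∀ z ∈ E, p z = (0 : ℂ) • z := fun z hz => by
    rw [zero_smul]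
    exact congrArg Subtype.val (Submodule.projectionOnto_apply_right h ⟨z, hz⟩)
  have hqD : ∀ z ∈ D, q z = (0 : ℂ) • z := fun z hz => by simp [q, hpD z hz]
  have hqE : ∀ z ∈ E, q z = (1 : ℂ) • z := fun z hz => by simp [q, hpE z hz]
  have hpm : ∀ z, p z ∈ D := fun z => Subtype.mem _
  have hqm : ∀ z, q z ∈ E := fun z => by
    obtain ⟨a, ha, b, hb, rfl⟩ := Submodule.mem_sup.1
      ((h.sup_eq_top ▸ Submodule.mem_top : z ∈ D ⊔ E))
    rw [map_add, hqD a ha, hqE b hb]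
    simpa using hb
  have hpq : ∀ z, p z + q z = z := fun z => by simp [q]
  refine ⟨p, q, hpm, hqm, hpq, fun z hz => ⟨by simp [hpD z hz], by simp [hqD z hz]⟩,
    fun z hz => ⟨by simp [hpE z hz], by simp [hqE z hz]⟩, fun z => ⟨?_, ?_, ?_⟩⟩
  · conv_lhs => rw [← hpq z, map_add, map_add, map_comul_of_mem hD hpD hpD (hpm z),
      map_comul_of_mem hE hpE hpE (hqm z)]
    simp
  · conv_lhs => rw [← hpq z, map_add, map_add, map_comul_of_mem hD hqD hqD (hpm z),
      map_comul_of_mem hE hqE hqE (hqm z)]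
    simp
  · rw [← hpq z, map_add, map_add, map_comul_of_mem hD hpD hqD (hpm z),
      map_comul_of_mem hE hpE hqE (hqm z)]
    simp

/-- In a direct sum of subcoalgebras, no nontrivial skew primitive element links
group-like elements of different summands. -/
lemma not_linked_of_isCompl (hD : IsSubcoalgebra D) (hE : IsSubcoalgebra E) (h : IsCompl D E)
    {x y : GroupLike ℂ C} (hx : x.val ∈ D) (hy : y.val ∈ E) : ¬ Linked x y := by
  obtain ⟨p, q, -, -, hpq, hD', hE', hc⟩ := exists_projections_of_isCompl hD hE h
  have hcx := x.isGroupLikeElem_val.counit_eq_one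
  have hcy := y.isGroupLikeElem_val.counit_eq_one
  rintro ⟨a, ha, hna⟩
  obtain ⟨h1, h2, -⟩ := hc a
  rw [ha, map_add, TensorProduct.map_tmul, TensorProduct.map_tmul, (hD' _ hx).1,
    (hE' _ hy).1] at h1
  rw [ha, map_add, TensorProduct.map_tmul, TensorProduct.map_tmul, (hD' _ hx).2,
    (hE' _ hy).2] at h2
  have h3 : Coalgebra.counit (R := ℂ) (p a) • x.val = p a := by
    simpa using congrArg (fun u => TensorProduct.lid ℂ C (Coalgebra.counit.rTensor C u)) h1
  have h4 : Coalgebra.counit (R := ℂ) (q a) • y.val = q a := by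
    simpa using congrArg (fun u => TensorProduct.rid ℂ C (Coalgebra.counit.lTensor C u)) h2
  have h5 : Coalgebra.counit (R := ℂ) a = 0 := by
    simpa [hcx, hcy] using congrArg (fun u => Coalgebra.counit (R := ℂ)
      (TensorProduct.lid ℂ C (Coalgebra.counit.rTensor C u))) ha
  rw [← hpq a, map_add] at h5
  apply hna
  rw [Submodule.mem_span_singleton]
  refine ⟨Coalgebra.counit (p a), ?_⟩
  conv_rhs => rw [← hpq a, ← h3, ← h4, eq_neg_of_add_eq_zero_right h5]
  rw [smul_sub, neg_smul, sub_eq_add_neg]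

/-- A coalgebra in which every nonzero subcoalgebra contains a group-like element is
indecomposable as soon as its group-like elements are connected by links. -/
lemma HasGroupLikes.isIndecomposableCoalgebra (h : HasGroupLikes C)
    (hlink : IsLinkIndecomposable C) : IsIndecomposableCoalgebra C := by
  obtain ⟨⟨x₀⟩, hlink⟩ := hlink
  refine ⟨⟨x₀.val, 0, x₀.isGroupLikeElem_val.ne_zero⟩, fun D E hD hE hDE => ?_⟩
  by_contra! hne
  obtain ⟨x, hxD, hx⟩ := h D hD hne.1
  obtain ⟨y, hyE, hy⟩ := h E hE hne.2
  have hdisj : ∀ z : GroupLike ℂ C, z.val ∈ D → z.val ∉ E := fun z hzD hzE =>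
    z.isGroupLikeElem_val.ne_zero (Submodule.disjoint_def.1 hDE.disjoint _ hzD hzE)
  have hor : ∀ z : GroupLike ℂ C, z.val ∈ D ∨ z.val ∈ E := by
    intro z
    obtain ⟨p, q, hp, hq, hpq, -, -, hc⟩ := exists_projections_of_isCompl hD hE hDE
    have hz := (hc z.val).2.2
    rw [z.isGroupLikeElem_val.comul_eq_tmul_self, TensorProduct.map_tmul] at hz
    rw [← hpq z.val]
    have h1 : Coalgebra.counit (R := ℂ) (p z.val) • q z.val = 0 := by
      simpa using congrArg (fun u => TensorProduct.lid ℂ C (Coalgebra.counit.rTensor C u)) hz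
    have h2 : Coalgebra.counit (R := ℂ) (q z.val) • p z.val = 0 := by
      simpa using congrArg (fun u => TensorProduct.rid ℂ C (Coalgebra.counit.lTensor C u)) hz
    rcases smul_eq_zero.1 h1 with h0 | h0
    · rcases smul_eq_zero.1 h2 with h3 | h3
      · have h4 := z.isGroupLikeElem_val.counit_eq_one
        rw [← hpq z.val, map_add, h0, h3, add_zero] at h4
        exact absurd h4 zero_ne_one
      · right; rw [h3, zero_add]; exact hq _
    · left; rw [h0, add_zero]; exact hp _
  have hiff : ∀ z w : GroupLike ℂ C, Relation.EqvGen Linked z w → (z.val ∈ D ↔ w.val ∈ D) := by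
    intro z w hzw
    induction hzw with
    | rel z w hzw =>
      constructor
      · intro hz
        exact (hor w).resolve_right fun hw => not_linked_of_isCompl hD hE hDE hz hw hzw
      · intro hw
        exact (hor z).resolve_right fun hz => not_linked_of_isCompl hE hD hDE.symm hz hw hzw
    | refl z => rfl
    | symm z w _ ih => exact ih.symm
    | trans z w v _ _ ih1 ih2 => exact ih1.trans ih2
  exact hdisj ⟨y, hy⟩ ((hiff ⟨x, hx⟩ ⟨y, hy⟩ (hlink _ _)).1 hxD) hyE

end Coalg

/-! ### Group-like elements and links of the bosonization -/

namespace YDModule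

variable {G : Type*} [Group G] {V : Type*} [AddCommGroup V] [Module ℂ V] (M : YDModule G V)

/-- The functional `b # h ↦ φ b` on the smash product, vanishing on `b # h'` for `h' ≠ h`. -/
def coeffForm (φ : M.NicholsAlgebra →ₗ[ℂ] ℂ) (h : G) : M.SmashProduct →ₗ[ℂ] ℂ :=
  φ ∘ₗ Finsupp.lapply h ∘ₗ
    (SkewMonoidAlgebra.coeffLinearEquiv (S := ℂ) (k := M.NicholsAlgebra) (G := G)).toLinearMap

lemma coeffForm_apply (φ : M.NicholsAlgebra →ₗ[ℂ] ℂ) (h : G) (x : M.SmashProduct) :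
    M.coeffForm φ h x = φ (x.coeff h) := rfl

open scoped Classical in
lemma coeffForm_lTensor (φ : M.NicholsAlgebra →ₗ[ℂ] ℂ) (h g : G)
    (u : M.SmashProduct ⊗[ℂ] M.NicholsAlgebra) :
    TensorProduct.rid ℂ _ ((M.coeffForm φ h).lTensor M.SmashProduct
      (M.incR u * (M.grp g ⊗ₜ M.grp g))) =
      if g = h then TensorProduct.rid ℂ _ (φ.lTensor M.SmashProduct u) * M.grp h else 0 := by
  induction u using TensorProduct.induction_on with
  | zero => simp
  | add x y hx hy =>
    simp only [map_add, add_mul, hx, hy]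
    split_ifs <;> simp
  | tmul s b =>
    simp only [Algebra.TensorProduct.map_tmul, AlgHom.id_apply,
      Algebra.TensorProduct.tmul_mul_tmul, inc_mul_grp, LinearMap.lTensor_tmul,
      TensorProduct.rid_tmul, coeffForm_apply, SkewMonoidAlgebra.coeff_single_apply]
    split_ifs with hg
    · rw [hg, smul_mul_assoc]
    · rw [map_zero, zero_smul]

/-- Pairing the second factor of the comultiplication with a functional extracts the
coefficient of a group element and differentiates it. -/
lemma coeffForm_lTensor_scomul (w : List M.Letter) (h : G) (x : M.SmashProduct) :
    TensorProduct.rid ℂ _ ((M.coeffForm (M.wordForm w) h).lTensor M.SmashProduct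
      (M.scomul x)) = M.inc (M.nderWord w (x.coeff h)) * M.grp (M.degWord w * h) := by
  classical
  refine M.smash_induction (p := fun x => TensorProduct.rid ℂ _
    ((M.coeffForm (M.wordForm w) h).lTensor M.SmashProduct (M.scomul x)) =
      M.inc (M.nderWord w (x.coeff h)) * M.grp (M.degWord w * h)) x ?_ (by simp) ?_
  · intro b g
    rw [inc_mul_grp, scomul_single, coeffForm_lTensor, wordForm_lTensor_ncomul,
      SkewMonoidAlgebra.coeff_single_apply]
    split_ifs
    · rw [grp_mul, mul_assoc]
    · simp
  · intro x y hx hy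
    simp only [map_add, SkewMonoidAlgebra.coeff_add, Finsupp.add_apply, hx, hy, add_mul]

lemma isGroupLikeElem_grp : letI := M.bialgebra
    ∀ g, IsGroupLikeElem ℂ (M.grp g) :=
  letI := M.bialgebra
  fun g => ⟨M.scounit_grp g, M.scomul_grp g⟩

/-- Every nonzero subcoalgebra of the bosonization contains an element of the group: a
nonzero coefficient of a nonzero element can be differentiated to a nonzero constant. -/
lemma exists_grp_mem_of_isSubcoalgebra : letI := M.bialgebra
    ∀ D : Submodule ℂ M.SmashProduct, IsSubcoalgebra D → D ≠ ⊥ → ∃ g, M.grp g ∈ D := by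
  let := M.bialgebra
  intro D hD hne
  obtain ⟨x, hx, hx0⟩ := D.exists_mem_ne_zero_of_ne_bot hne
  obtain ⟨h, hh⟩ : ∃ h, x.coeff h ≠ 0 := by
    by_contra! hz
    exact hx0 (SkewMonoidAlgebra.ext hz)
  obtain ⟨w, c, hc, hw⟩ := M.exists_nderWord_eq_algebraMap hh
  refine ⟨M.degWord w * h, ?_⟩
  have := hD.rid_lTensor_comul_mem (M.coeffForm (M.wordForm w) h) hx
  rw [show Coalgebra.comul (R := ℂ) x = M.scomul x from rfl, coeffForm_lTensor_scomul, hw,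
    AlgHom.commutes, ← Algebra.smul_def] at this
  exact (D.smul_mem_iff hc).1 this

lemma hasGroupLikes_smash : letI := M.bialgebra
    HasGroupLikes M.SmashProduct :=
  letI := M.bialgebra
  fun D hD hne =>
    let ⟨g, hg⟩ := M.exists_grp_mem_of_isSubcoalgebra D hD hne
    ⟨M.grp g, hg, M.isGroupLikeElem_grp g⟩

lemma exists_grp_eq_of_isGroupLikeElem : letI := M.bialgebra
    ∀ x : M.SmashProduct, IsGroupLikeElem ℂ x → ∃ g, M.grp g = x := by
  let := M.bialgebra
  intro x hx
  obtain ⟨g, hg⟩ := M.exists_grp_mem_of_isSubcoalgebra _ hx.isSubcoalgebra_span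
    (by simpa using hx.ne_zero)
  refine ⟨g, ?_⟩
  obtain ⟨c, hc⟩ := Submodule.mem_span_singleton.1 hg
  have h1 := congrArg (Coalgebra.counit (R := ℂ)) hc
  rw [map_smul, hx.counit_eq_one, (M.isGroupLikeElem_grp g).counit_eq_one, smul_eq_mul,
    mul_one] at h1
  rw [← hc, h1, one_smul]

lemma coradical_smash : letI := M.bialgebra
    coradical M.SmashProduct = Submodule.span ℂ (Set.range M.grp) := by
  let := M.bialgebra
  rw [M.hasGroupLikes_smash.coradical_eq]
  congr 1
  ext x
  exact ⟨fun hx => M.exists_grp_eq_of_isGroupLikeElem x hx, fun ⟨g, hg⟩ =>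
    hg ▸ M.isGroupLikeElem_grp g⟩

/-- A nonzero homogeneous vector of degree `g` links `h` to `g h`. -/
lemma linked_grp : letI := M.bialgebra
    ∀ {g : G} (_ : M.grade g ≠ ⊥) (h : G),
      Linked (C := M.SmashProduct) ⟨M.grp h, M.isGroupLikeElem_grp h⟩
        ⟨M.grp (g * h), M.isGroupLikeElem_grp (g * h)⟩ := by
  let := M.bialgebra
  intro g hg h
  obtain ⟨v, hv, hv0⟩ := (M.grade g).exists_mem_ne_zero_of_ne_bot hg
  obtain ⟨l, hl⟩ : ∃ l : M.Letter, l.1.2 v ≠ 0 := by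
    by_contra! hz
    exact hv0 (M.eq_zero_of_supportedAt hz)
  refine ⟨M.vec v * M.grp h, ?_, fun hmem => hl ?_⟩
  · change M.scomul _ = _
    rw [map_mul, M.scomul_vec hv, scomul_grp, add_mul, Algebra.TensorProduct.tmul_mul_tmul,
      Algebra.TensorProduct.tmul_mul_tmul, one_mul, ← grp_mul]
  · obtain ⟨c, hc⟩ := Submodule.mem_span_singleton.1 hmem
    -- the functional `b # h ↦ ε (∂ b)` sees `v # h` but no element of the group
    have hzero : ∀ k, M.coeffForm (M.wordForm [l]) h (M.grp k) = 0 := by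
      classical
      intro k
      rw [coeffForm_apply, grp, SkewMonoidAlgebra.coeff_single_apply]
      split_ifs
      · simp [wordForm, nderWord, nder_one]
      · simp
    have hval := congrArg (M.coeffForm (M.wordForm [l]) h) hc
    rw [map_smul, map_sub, hzero, hzero, sub_zero, smul_zero, vec_eq, inc_mul_grp,
      coeffForm_apply, SkewMonoidAlgebra.coeff_single, Finsupp.single_eq_same] at hval
    simpa [wordForm, nderWord, nder_nι] using hval.symm

lemma isLinkIndecomposable_smash (hM : M.IsIndecomposable) : letI := M.bialgebra
    IsLinkIndecomposable M.SmashProduct := by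
  let := M.bialgebra
  let γ : G → GroupLike ℂ M.SmashProduct := fun g => ⟨M.grp g, M.isGroupLikeElem_grp g⟩
  have key : ∀ g h, Relation.EqvGen Linked (γ h) (γ (g * h)) := by
    intro g
    have hg : g ∈ Subgroup.closure {g : G | M.grade g ≠ ⊥} := by
      rw [show Subgroup.closure {g : G | M.grade g ≠ ⊥} = ⊤ from hM]; trivial
    induction hg using Subgroup.closure_induction with
    | mem g hg => exact fun h => .rel _ _ (M.linked_grp hg h)
    | one => intro h; rw [one_mul]; exact .refl _
    | mul a b _ _ ha hb =>
      intro h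
      rw [mul_assoc]
      exact .trans _ _ _ (hb h) (ha (b * h))
    | inv a _ ha =>
      intro h
      have := ha (a⁻¹ * h)
      rw [mul_inv_cancel_left] at this
      exact .symm _ _ this
  have hγ : ∀ x, ∃ g, γ g = x := fun x => by
    obtain ⟨g, hg⟩ := M.exists_grp_eq_of_isGroupLikeElem x.val x.isGroupLikeElem_val
    exact ⟨g, GroupLike.val_injective hg⟩
  refine ⟨⟨γ 1⟩, fun x y => ?_⟩
  obtain ⟨g, rfl⟩ := hγ x
  obtain ⟨h, rfl⟩ := hγ y
  have := key (h * g⁻¹) g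
  rwa [inv_mul_cancel_right] at this

end YDModule

/-! ### A criterion for a Nichols algebra of diagonal type to be finite-dimensional -/

/-- If pairwise commuting finite-dimensional subspaces `P j` containing `1` have stationary powers,
then an algebra that equals each of its subspaces which contain `1` and are stable under
multiplication by all `P j` is finite-dimensional. -/
lemma finiteDimensional_of_commuting_submodules {B : Type*} [Ring B] [Algebra ℂ B] {J : Type*}
    [Finite J] (P : J → Submodule ℂ B) (hfg : ∀ j, (P j).FG) (hone : ∀ j, 1 ≤ P j)
    (hcomm : ∀ j k, Commute (P j) (P k)) (hpow : ∀ j, ∃ n, P j * P j ^ n ≤ P j ^ n)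
    (hgen : ∀ L : Submodule ℂ B, 1 ≤ L → (∀ j, P j * L ≤ L) → L = ⊤) :
    FiniteDimensional ℂ B := by
  classical
  cases nonempty_fintype J
  choose n hn using hpow
  let L : List J → Submodule ℂ B := fun l => (l.map fun j => P j ^ n j).prod
  have h1 : ∀ l, 1 ≤ L l := by
    intro l
    induction l with
    | nil => exact le_rfl
    | cons a l ih =>
      simp only [L, List.map_cons, List.prod_cons]
      exact one_le_mul (one_le_pow_of_one_le' (hone a) _) ih
  have hf : ∀ l, (L l).FG := by
    intro l
    induction l with
    | nil => exact ⟨{1}, by simp [L, Submodule.one_eq_span]⟩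
    | cons a l ih =>
      simp only [L, List.map_cons, List.prod_cons]
      exact ((hfg a).pow _).mul ih
  have hs : ∀ j l, j ∈ l → P j * L l ≤ L l := by
    intro j l hj
    induction l with
    | nil => exact absurd hj List.not_mem_nil
    | cons a l ih =>
      simp only [L, List.map_cons, List.prod_cons]
      rw [← mul_assoc]
      by_cases h : j = a
      · subst h
        exact mul_le_mul_left (hn j) _
      · rw [((hcomm j a).pow_right (n a)).eq, mul_assoc]
        exact mul_le_mul_right (ih (by simpa [h] using hj)) _
  have htop := hgen (L Finset.univ.toList) (h1 _) fun j => hs j _ (by simp)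
  exact ⟨htop ▸ hf _⟩

/-- If `x ^ N = 0`, then the powers of the span of `1` and `x` are stationary. The generator `x` is
listed twice so that the span has the shape of `span_mul_pow_le_of_alternating`. -/
lemma span_mul_pow_le_of_pow_eq_zero {B : Type*} [Ring B] [Algebra ℂ B] {x : B} {N : ℕ}
    (h : x ^ N = 0) :
    Submodule.span ℂ {1, x, x} * Submodule.span ℂ {1, x, x} ^ N ≤
      Submodule.span ℂ {1, x, x} ^ N := by
  set P := Submodule.span ℂ {1, x, x} with hP
  have h1 : (1 : B) ∈ P := Submodule.subset_span (by simp)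
  have hx : x ∈ P := Submodule.subset_span (by simp)
  let U : Submodule ℂ B := Submodule.span ℂ (Set.range fun i : ℕ => x ^ i)
  have hU : P * U ≤ U := by
    rw [hP, Submodule.span_mul_span, Submodule.span_le]
    rintro _ ⟨a, ha, _, ⟨i, rfl⟩, rfl⟩
    simp only [Set.mem_insert_iff, Set.mem_singleton_iff, or_self] at ha
    rcases ha with rfl | rfl
    · exact Submodule.subset_span ⟨i, (one_mul _).symm⟩
    · exact Submodule.subset_span ⟨i + 1, pow_succ' _ _⟩
  have hle : U ≤ P ^ N := by
    rw [Submodule.span_le]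
    rintro _ ⟨i, rfl⟩
    change x ^ i ∈ P ^ N
    rcases lt_or_ge i N with hi | hi
    · obtain ⟨k, rfl⟩ := Nat.exists_eq_add_of_lt hi
      rw [show i + k + 1 = i + (k + 1) by ring, pow_add, ← mul_one (x ^ i)]
      refine Submodule.mul_mem_mul (Submodule.pow_mem_pow _ hx _) ?_
      simpa using Submodule.pow_mem_pow _ h1 (k + 1)
    · rw [← Nat.add_sub_cancel' hi, pow_add, h, zero_mul]
      exact zero_mem _
  have hpow : ∀ n, P ^ n ≤ U := by
    intro n
    induction n with
    | zero =>
      rw [pow_zero, Submodule.one_le]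
      exact Submodule.subset_span ⟨0, pow_zero _⟩
    | succ n ih => rw [pow_succ']; exact (mul_le_mul_right ih _).trans hU
  rw [← pow_succ']
  exact (hpow _).trans hle

/-- If `x ^ 2 = y ^ 2 = 0` and the alternating words of length five in `x` and `y` vanish, then the
powers of the span of `1`, `x` and `y` are stationary. -/
lemma span_mul_pow_le_of_alternating {B : Type*} [Ring B] [Algebra ℂ B] {x y : B}
    (hxx : x * x = 0) (hyy : y * y = 0) (h1 : x * (y * (x * (y * x))) = 0)
    (h2 : y * (x * (y * (x * y))) = 0) :
    Submodule.span ℂ {1, x, y} * Submodule.span ℂ {1, x, y} ^ 4 ≤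
      Submodule.span ℂ {1, x, y} ^ 4 := by
  set P := Submodule.span ℂ {1, x, y} with hP
  have m1 : (1 : B) ∈ P := Submodule.subset_span (by simp)
  have mx : x ∈ P := Submodule.subset_span (by simp)
  have my : y ∈ P := Submodule.subset_span (by simp)
  let W : Set B := {1, x, y, x * y, y * x, x * (y * x), y * (x * y), x * (y * (x * y)),
    y * (x * (y * x))}
  have hxx' : ∀ z, x * (x * z) = 0 := fun z => by rw [← mul_assoc, hxx, zero_mul]
  have hyy' : ∀ z, y * (y * z) = 0 := fun z => by rw [← mul_assoc, hyy, zero_mul]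
  have hU : P * Submodule.span ℂ W ≤ Submodule.span ℂ W := by
    have hW : ∀ w ∈ W, w ∈ Submodule.span ℂ W := fun w hw => Submodule.subset_span hw
    rw [hP, Submodule.span_mul_span, Submodule.span_le]
    rintro _ ⟨a, ha, b, hb, rfl⟩
    simp only [Set.mem_insert_iff, Set.mem_singleton_iff] at ha
    change a * b ∈ Submodule.span ℂ W
    rcases ha with rfl | rfl | rfl
    · rw [one_mul]; exact hW _ hb
    all_goals
      simp only [W, Set.mem_insert_iff, Set.mem_singleton_iff] at hb
      rcases hb with rfl | rfl | rfl | rfl | rfl | rfl | rfl | rfl | rfl <;>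
        first
        | (simp only [hxx, hyy, hxx', hyy', h1, h2]; exact zero_mem _)
        | exact hW _ (by simp [W])
  have hle : Submodule.span ℂ W ≤ P ^ 4 := by
    have e : P ^ 4 = P * (P * (P * P)) := by
      rw [pow_succ', pow_succ', pow_two]
    rw [Submodule.span_le, e]
    have key : ∀ a ∈ P, ∀ b ∈ P, ∀ c ∈ P, ∀ d ∈ P, a * (b * (c * d)) ∈ P * (P * (P * P)) :=
      fun a ha b hb c hc d hd => Submodule.mul_mem_mul ha (Submodule.mul_mem_mul hb
        (Submodule.mul_mem_mul hc hd))
    intro w hw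
    simp only [W, Set.mem_insert_iff, Set.mem_singleton_iff] at hw
    change w ∈ P * (P * (P * P))
    rcases hw with rfl | rfl | rfl | rfl | rfl | rfl | rfl | rfl | rfl
    · simpa using key 1 m1 1 m1 1 m1 1 m1
    · simpa using key 1 m1 1 m1 1 m1 _ mx
    · simpa using key 1 m1 1 m1 1 m1 _ my
    · simpa using key 1 m1 1 m1 _ mx _ my
    · simpa using key 1 m1 1 m1 _ my _ mx
    · simpa using key 1 m1 _ mx _ my _ mx
    · simpa using key 1 m1 _ my _ mx _ my
    · exact key _ mx _ my _ mx _ my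
    · exact key _ my _ mx _ my _ mx
  have hpow : ∀ n, P ^ n ≤ Submodule.span ℂ W := by
    intro n
    induction n with
    | zero =>
      rw [pow_zero, Submodule.one_le]
      exact Submodule.subset_span (by simp [W])
    | succ n ih => rw [pow_succ']; exact (mul_le_mul_right ih _).trans hU
  rw [← pow_succ']
  exact (hpow _).trans hle

namespace YDModule

variable {G : Type*} [Group G] {V : Type*} [AddCommGroup V] [Module ℂ V] (M : YDModule G V)

/-- The vectors `x j` span `V` and diagonalize the braiding, with matrix `q`: any group element
that occurs as a degree of a component of `x j` multiplies `x k` by `q j k`. -/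
structure IsDiagonal {J : Type*} (x : J → V) (q : J → J → ℂ) : Prop where
  span_eq_top : Submodule.span ℂ (Set.range x) = ⊤
  act_eq : ∀ (l : M.Letter) (j k : J), l.1.2 (x j) ≠ 0 → M.act l.1.1 (x k) = q j k • x k

variable {M} {J : Type*} {x : J → V} {q : J → J → ℂ}

namespace IsDiagonal

variable (h : M.IsDiagonal x q)

include h

lemma smul_nact (l : M.Letter) (j k : J) :
    l.1.2 (x j) • M.nact l.1.1 (M.nι (x k)) = (l.1.2 (x j) * q j k) • M.nι (x k) := by
  by_cases h0 : l.1.2 (x j) = 0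
  · rw [h0, zero_mul, zero_smul, zero_smul]
  · rw [nact_nι, h.act_eq l j k h0, map_smul, smul_smul]

lemma smul_nact_mul (l : M.Letter) (j k : J) (z : M.NicholsAlgebra) :
    l.1.2 (x j) • M.nact l.1.1 (M.nι (x k) * z) =
      q j k • (M.nι (x k) * (l.1.2 (x j) • M.nact l.1.1 z)) := by
  rw [map_mul, ← smul_mul_assoc, h.smul_nact, mul_smul_comm, smul_mul_assoc, smul_smul, mul_comm]

omit h in
lemma nder_nι_mul (l : M.Letter) (v : V) (z : M.NicholsAlgebra) :
    M.nder l (M.nι v * z) = l.1.2 v • M.nact l.1.1 z + M.nι v * M.nder l z := by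
  rw [nder_mul, nder_nι, ← Algebra.smul_def]

omit h in
lemma nder_nι' (l : M.Letter) (v : V) :
    M.nder l (M.nι v) = l.1.2 v • (1 : M.NicholsAlgebra) := by
  rw [nder_nι, Algebra.algebraMap_eq_smul_one]

/-- The quantum plane relation for two unlinked vertices. -/
lemma mul_eq_smul_mul {j k : J} (hq : q j k * q k j = 1) :
    M.nι (x j) * M.nι (x k) = q j k • (M.nι (x k) * M.nι (x j)) := by
  rw [← sub_eq_zero]
  refine M.eq_zero_of_nder_eq_zero (by simp [naug_nι]) fun l => ?_
  rw [map_sub, map_smul, nder_nι_mul, nder_nι_mul, h.smul_nact, h.smul_nact, nder_nι', nder_nι',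
    mul_smul_comm, mul_smul_comm, mul_one, mul_one, smul_add, smul_smul, smul_smul]
  rw [show q j k * (l.1.2 (x k) * q k j) = (q j k * q k j) * l.1.2 (x k) by ring, hq, one_mul,
    mul_comm]
  abel

lemma nder_pow (l : M.Letter) (j : J) (n : ℕ) :
    M.nder l (M.nι (x j) ^ (n + 1)) =
      (l.1.2 (x j) * ∑ i ∈ Finset.range (n + 1), q j j ^ i) • M.nι (x j) ^ n := by
  have hp : ∀ n, l.1.2 (x j) • M.nact l.1.1 (M.nι (x j) ^ n) =
      (l.1.2 (x j) * q j j ^ n) • M.nι (x j) ^ n := by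
    intro n
    induction n with
    | zero => simp
    | succ n ih =>
      rw [pow_succ', h.smul_nact_mul, ih, mul_smul_comm, smul_smul, ← pow_succ', pow_succ]
      congr 1
      ring
  induction n with
  | zero => simp [nder_nι']
  | succ n ih =>
    rw [pow_succ', nder_nι_mul, hp, ih, mul_smul_comm, ← pow_succ', ← add_smul,
      Finset.sum_range_succ _ (n + 1)]
    congr 1
    ring

lemma pow_eq_zero {j : J} {N : ℕ} (hN : N ≠ 0) (hq1 : q j j ≠ 1) (hqN : q j j ^ N = 1) :
    M.nι (x j) ^ N = 0 := by
  obtain ⟨n, rfl⟩ := Nat.exists_eq_succ_of_ne_zero hN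
  refine M.eq_zero_of_nder_eq_zero (by simp [naug_nι]) fun l => ?_
  have := geom_sum_eq hq1 (n + 1)
  rw [Nat.succ_eq_add_one] at hqN
  rw [hqN, sub_self, zero_div] at this
  rw [h.nder_pow, this, mul_zero, zero_smul]

lemma mul_self_eq_zero {j : J} (hq : q j j = -1) : M.nι (x j) * M.nι (x j) = 0 := by
  rw [← pow_two]
  exact h.pow_eq_zero two_ne_zero (by rw [hq]; norm_num) (by rw [hq]; norm_num)

/-- The relation `(x y - q y x) ^ 2 = 0` for two linked vertices of type `A₂` at `-1`, expanded
by means of `x ^ 2 = y ^ 2 = 0`. -/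
lemma alternating_relation {j k : J} (hj : q j j = -1) (hk : q k k = -1)
    (hjk : q j k * q k j = -1) :
    M.nι (x j) * (M.nι (x k) * (M.nι (x j) * M.nι (x k))) +
      q j k ^ 2 • (M.nι (x k) * (M.nι (x j) * (M.nι (x k) * M.nι (x j)))) = 0 := by
  have hx := h.mul_self_eq_zero hj
  have hy := h.mul_self_eq_zero hk
  have hx' : ∀ z, M.nι (x j) * (M.nι (x j) * z) = 0 := fun z => by rw [← mul_assoc, hx, zero_mul]
  have hy' : ∀ z, M.nι (x k) * (M.nι (x k) * z) = 0 := fun z => by rw [← mul_assoc, hy, zero_mul]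
  refine M.eq_zero_of_nder_eq_zero (by simp [naug_nι]) fun l => ?_
  simp only [map_add, map_smul, nder_nι_mul, h.smul_nact_mul, h.smul_nact, nder_nι',
    mul_add, mul_smul_comm, smul_add, smul_smul, mul_one, hx, hy, hx', hy', smul_zero, hj, hk,
    zero_add]
  have e : (q j k * q k j) ^ 2 = 1 := by rw [hjk]; norm_num
  generalize M.nι (x k) * (M.nι (x j) * M.nι (x k)) = s
  generalize M.nι (x j) * (M.nι (x k) * M.nι (x j)) = t
  match_scalars
  · ring
  · linear_combination (-l.1.2 (x k)) * e

lemma alternating_five {j k : J} (hj : q j j = -1) (hk : q k k = -1)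
    (hjk : q j k * q k j = -1) :
    M.nι (x j) * (M.nι (x k) * (M.nι (x j) * (M.nι (x k) * M.nι (x j)))) = 0 := by
  have hx := h.mul_self_eq_zero hj
  have hr := congrArg (· * M.nι (x j)) (h.alternating_relation hj hk hjk)
  simpa only [add_mul, smul_mul_assoc, mul_assoc, hx, mul_zero, smul_zero, add_zero,
    zero_mul] using hr

/-- A Nichols algebra of diagonal type is finite-dimensional if the connected components of its
generalized Dynkin diagram are single vertices with a nontrivial root of unity, or pairs
`{j, σ j}` of type `A₂` at `-1`. -/
theorem finiteDimensional [Finite J] (σ : J → J) (hσ : ∀ j, σ (σ j) = j)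
    (hfar : ∀ j k, k ≠ j → k ≠ σ j → q j k * q k j = 1)
    (hpair : ∀ j, σ j ≠ j → q j j = -1 ∧ q j (σ j) * q (σ j) j = -1)
    (hone : ∀ j, q j j ≠ 1) (hroot : ∀ j, ∃ N ≠ 0, q j j ^ N = 1) :
    FiniteDimensional ℂ M.NicholsAlgebra := by
  let P : J → Submodule ℂ M.NicholsAlgebra := fun j =>
    Submodule.span ℂ {1, M.nι (x j), M.nι (x (σ j))}
  have hmem1 : ∀ j, 1 ∈ P j := fun j => Submodule.subset_span (by simp)
  have hmemx : ∀ j, M.nι (x j) ∈ P j := fun j => Submodule.subset_span (by simp)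
  have hmemy : ∀ j, M.nι (x (σ j)) ∈ P j := fun j => Submodule.subset_span (by simp)
  have hle : ∀ j k, k ≠ j → k ≠ σ j → P j * P k ≤ P k * P j := by
    intro j k h1 h2
    have h3 : σ k ≠ j := fun e => h2 (by rw [← e, hσ])
    have h4 : σ k ≠ σ j := fun e => h1 (by rw [← hσ k, e, hσ])
    have hsw : ∀ a b, q a b * q b a = 1 → M.nι (x a) ∈ P j → M.nι (x b) ∈ P k →
        M.nι (x a) * M.nι (x b) ∈ P k * P j := fun a b hab ha hb => by
      rw [h.mul_eq_smul_mul hab]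
      exact Submodule.smul_mem _ _ (Submodule.mul_mem_mul hb ha)
    have hk1 : ∀ a ∈ P j, a ∈ P k * P j := fun a ha => by
      simpa using Submodule.mul_mem_mul (hmem1 k) ha
    have hk2 : ∀ b ∈ P k, b ∈ P k * P j := fun a ha => by
      simpa using Submodule.mul_mem_mul ha (hmem1 j)
    simp only [P]
    rw [Submodule.span_mul_span, Submodule.span_le]
    rintro _ ⟨a, ha, b, hb, rfl⟩
    change a * b ∈ P k * P j
    simp only [Set.mem_insert_iff, Set.mem_singleton_iff] at ha hb
    rcases ha with rfl | rfl | rfl <;> rcases hb with rfl | rfl | rfl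
    · simpa using hk1 1 (hmem1 j)
    · simpa using hk2 _ (hmemx k)
    · simpa using hk2 _ (hmemy k)
    · simpa using hk1 _ (hmemx j)
    · exact hsw _ _ (hfar _ _ h1 h2) (hmemx j) (hmemx k)
    · exact hsw _ _ (hfar _ _ h3 h4) (hmemx j) (hmemy k)
    · simpa using hk1 _ (hmemy j)
    · exact hsw _ _ (hfar _ _ h2 (by rwa [hσ])) (hmemy j) (hmemx k)
    · exact hsw _ _ (hfar _ _ h4 (by rwa [hσ])) (hmemy j) (hmemy k)
  refine finiteDimensional_of_commuting_submodules P
    (fun j => Submodule.fg_span (Set.toFinite _)) (fun j => Submodule.one_le.2 (hmem1 j))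
    (fun j k => ?_) (fun j => ?_) (fun L h1 hL => ?_)
  · by_cases e1 : k = j
    · rw [e1]
    by_cases e2 : k = σ j
    · have : P k = P j := by
        simp only [P, e2, hσ]
        rw [Set.pair_comm]
      rw [this]
    exact le_antisymm (hle j k e1 e2) (hle k j (Ne.symm e1) (fun e => e2 (by rw [e, hσ])))
  · by_cases e : σ j = j
    · obtain ⟨N, hN, hqN⟩ := hroot j
      refine ⟨N, ?_⟩
      simp only [P, e]
      exact span_mul_pow_le_of_pow_eq_zero (h.pow_eq_zero hN (hone j) hqN)
    · obtain ⟨hj, hjk⟩ := hpair j e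
      obtain ⟨hk, -⟩ := hpair (σ j) (fun e' => e (by rw [hσ] at e'; exact e'.symm))
      refine ⟨4, span_mul_pow_le_of_alternating (h.mul_self_eq_zero hj) (h.mul_self_eq_zero hk)
        (h.alternating_five hj hk hjk) (h.alternating_five hk hj (by rw [mul_comm, hjk]))⟩
  · have key : ∀ b : M.NicholsAlgebra, ∀ u ∈ L, b * u ∈ L := by
      intro b
      refine M.nichols_induction (p := fun b => ∀ u ∈ L, b * u ∈ L) b ?_ ?_ ?_ ?_
      · intro c u hu
        rw [← Algebra.smul_def]
        exact L.smul_mem c hu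
      · intro g v hvg u hu
        clear hvg
        have hv : v ∈ Submodule.span ℂ (Set.range x) := by rw [h.span_eq_top]; trivial
        induction hv using Submodule.span_induction with
        | mem v hv =>
          obtain ⟨j, rfl⟩ := hv
          exact hL j (Submodule.mul_mem_mul (hmemx j) hu)
        | zero => rw [map_zero, zero_mul]; exact zero_mem _
        | add v w _ _ hv hw => rw [map_add, add_mul]; exact add_mem hv hw
        | smul c v _ hv => rw [map_smul, smul_mul_assoc]; exact L.smul_mem c hv
      · intro a b ha hb u hu
        rw [mul_assoc]
        exact ha _ (hb u hu)
      · intro a b ha hb u hu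
        rw [add_mul]
        exact add_mem (ha u hu) (hb u hu)
    refine Submodule.eq_top_iff'.2 fun b => ?_
    have := key b 1 (Submodule.one_le.1 h1)
    rwa [mul_one] at this

end IsDiagonal

end YDModule

/-! ### Groups with commutator subgroup of order two -/

/-- The element `z` is central of order dividing two, and all commutators lie in `{1, z}`. -/
structure IsCommutatorGenerator {G : Type*} [Group G] (z : G) : Prop where
  mul_self : z * z = 1
  mul_comm : ∀ g, z * g = g * z
  mul_eq : ∀ g h : G, g * h = h * g ∨ g * h = z * (h * g)

lemma exists_isCommutatorGenerator {G : Type*} [Group G]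
    (hG : Nonempty (commutator G ≃* Multiplicative (ZMod 2))) :
    ∃ z : G, IsCommutatorGenerator z ∧ commutator G ≤ Subgroup.center G := by
  obtain ⟨e⟩ := hG
  have htwo : ∀ a b : commutator G, a ≠ 1 → b ≠ 1 → a = b := by
    intro a b ha hb
    have hdec : ∀ c d : Multiplicative (ZMod 2), c ≠ 1 → d ≠ 1 → c = d := by decide
    exact e.injective (hdec _ _ (by simpa using ha) (by simpa using hb))
  have hsq : ∀ a : commutator G, a * a = 1 := by
    intro a
    have hdec : ∀ c : Multiplicative (ZMod 2), c * c = 1 := by decide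
    exact e.injective (by rw [map_mul, hdec, map_one])
  let ζ : commutator G := e.symm (Multiplicative.ofAdd 1)
  have hζ : ζ ≠ 1 := by
    intro h
    have : Multiplicative.ofAdd (1 : ZMod 2) = 1 := by
      simp [ζ] at h
    exact absurd this (by decide)
  have hcen : ∀ a : commutator G, ∀ g : G, g * a * g⁻¹ = a := by
    intro a g
    by_cases ha : a = 1
    · simp [ha]
    have hm : g * a * g⁻¹ ∈ commutator G := Subgroup.Normal.conj_mem inferInstance _ a.2 g
    refine congrArg Subtype.val (htwo ⟨_, hm⟩ a (fun h => ha ?_) ha)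
    have h1 : g * a * g⁻¹ = 1 := congrArg Subtype.val h
    exact Subtype.ext (conj_eq_one_iff.1 h1)
  refine ⟨ζ, ⟨congrArg Subtype.val (hsq ζ), fun g => ?_, fun g h => ?_⟩, fun a ha => ?_⟩
  · have := hcen ζ g
    rw [mul_inv_eq_iff_eq_mul] at this
    exact this.symm
  · have hm : ⁅g, h⁆ ∈ commutator G :=
      Subgroup.commutator_mem_commutator (Subgroup.mem_top g) (Subgroup.mem_top h)
    by_cases h1 : ⁅g, h⁆ = 1
    · exact Or.inl (commutatorElement_eq_one_iff_mul_comm.1 h1)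
    · right
      have h2 : (⟨_, hm⟩ : commutator G) = ζ := htwo _ _ (fun e => h1 (congrArg Subtype.val e)) hζ
      rw [← h2]
      simp [commutatorElement_def, mul_assoc]
  · rw [Subgroup.mem_center_iff]
    intro g
    have := hcen ⟨a, ha⟩ g
    rwa [mul_inv_eq_iff_eq_mul] at this

section csign

variable {G : Type*} [Group G]

open scoped Classical in
/-- The commutator form with values in `{1, -1}`: it is `1` on commuting pairs and `-1` on all
others. -/
def csign (g h : G) : ℂ := if Commute g h then 1 else -1

lemma csign_eq_one_iff {g h : G} : csign g h = 1 ↔ Commute g h := by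
  unfold csign
  split_ifs with hc
  · simp [hc]
  · simp only [hc, iff_false]; norm_num

lemma csign_of_not_commute {g h : G} (hc : ¬ Commute g h) : csign g h = -1 := if_neg hc

lemma csign_self (g : G) : csign g g = 1 := csign_eq_one_iff.2 (Commute.refl g)

lemma csign_comm (g h : G) : csign g h = csign h g := by
  classical
  unfold csign
  exact if_congr ⟨Commute.symm, Commute.symm⟩ rfl rfl

variable {z : G} (hz : IsCommutatorGenerator z)

include hz

/-- The commutator form is multiplicative. -/
lemma IsCommutatorGenerator.csign_mul (g h k : G) :
    csign g (h * k) = csign g h * csign g k := by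
  by_cases h1 : Commute g h
  · rw [csign_eq_one_iff.2 h1, one_mul]
    by_cases h2 : Commute g k
    · rw [csign_eq_one_iff.2 h2, csign_eq_one_iff.2 (h1.mul_right h2)]
    · rw [csign_of_not_commute h2, csign_of_not_commute]
      intro h3
      have := h1.inv_right.mul_right h3
      rw [inv_mul_cancel_left] at this
      exact h2 this
  · rw [csign_of_not_commute h1]
    by_cases h2 : Commute g k
    · rw [csign_eq_one_iff.2 h2, csign_of_not_commute, mul_one]
      intro h3
      have := h3.mul_right h2.inv_right
      rw [mul_inv_cancel_right] at this
      exact h1 this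
    · rw [csign_of_not_commute h2, csign_eq_one_iff.2]
      · norm_num
      · have e1 := (hz.mul_eq g h).resolve_left h1
        have e2 := (hz.mul_eq g k).resolve_left h2
        calc g * (h * k) = (g * h) * k := (mul_assoc _ _ _).symm
          _ = z * (h * (g * k)) := by rw [e1]; simp only [mul_assoc]
          _ = z * (h * z * (k * g)) := by rw [e2]; simp only [mul_assoc]
          _ = z * z * (h * k * g) := by rw [← hz.mul_comm h]; simp only [mul_assoc]
          _ = h * k * g := by rw [hz.mul_self, one_mul]

lemma IsCommutatorGenerator.csign_pow (g h : G) (n : ℕ) : csign g (h ^ n) = csign g h ^ n := by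
  induction n with
  | zero => rw [pow_zero, pow_zero, csign_eq_one_iff]; exact Commute.one_right g
  | succ n ih => rw [pow_succ, hz.csign_mul, ih, pow_succ]

/-- An element with a central power of odd exponent is central. -/
lemma IsCommutatorGenerator.commute_of_odd {g : G} {n : ℕ} (hn : Odd n)
    (hg : g ^ n ∈ Subgroup.center G) (h : G) : Commute g h := by
  by_contra hc
  have h1 : csign h (g ^ n) = 1 := csign_eq_one_iff.2 (Subgroup.mem_center_iff.1 hg h)
  rw [hz.csign_pow, csign_of_not_commute (fun e => hc e.symm), hn.neg_one_pow] at h1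
  norm_num at h1

end csign

/-- A subgroup that generates the group together with central commutators is everything. -/
lemma eq_top_of_forall_exists_mul_commutator {G : Type*} [Group G] {H : Subgroup G}
    (hc : commutator G ≤ Subgroup.center G) (hH : ∀ g : G, ∃ h ∈ H, ∃ c ∈ commutator G, g = h * c) :
    H = ⊤ := by
  have hle : commutator G ≤ H := by
    rw [commutator_def, Subgroup.commutator_le]
    intro a _ b _
    obtain ⟨h, hh, c, hcc, rfl⟩ := hH a
    obtain ⟨k, hk, d, hd, rfl⟩ := hH b
    have e1 := Subgroup.mem_center_iff.1 (hc hcc)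
    have e2 := Subgroup.mem_center_iff.1 (hc hd)
    have : ⁅h * c, k * d⁆ = ⁅h, k⁆ := by
      have f1 : h * c * (k * d) = (h * k) * (c * d) := by
        rw [mul_assoc, ← mul_assoc c, ← e1 k]; simp only [mul_assoc]
      have f2 : k * d * (h * c) = (k * h) * (c * d) := by
        rw [mul_assoc, ← mul_assoc d, ← e2 h, mul_assoc h, e1 d]; simp only [mul_assoc]
      rw [commutatorElement_def, commutatorElement_def, mul_assoc _ (h * c)⁻¹, ← mul_inv_rev, f1,
        f2]
      group
    rw [this, commutatorElement_def]
    exact H.mul_mem (H.mul_mem (H.mul_mem hh hk) (H.inv_mem hh)) (H.inv_mem hk)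
  refine eq_top_iff.2 fun g _ => ?_
  obtain ⟨h, hh, c, hcc, rfl⟩ := hH g
  exact H.mul_mem hh (hle hcc)

/-! ### Generators dual to characters -/

/-- The family `g` generates `G` and has a dual family of linear characters `ψ`: `ψ i` is trivial
on `g j` for `j ≠ i` and has on `g i` a value of order `m i`. Moreover `m i` is a power of two
for all `g i` that are not central. The model is a lift to `G` of a basis of the abelianization. -/
def IsDualizable {G : Type*} [Group G] {ι : Type*} (g : ι → G) (m : ι → ℕ) : Prop :=
  Subgroup.closure (Set.range g) = ⊤ ∧
    (∀ i, (∃ h, ¬ Commute (g i) h) → ∃ e, m i = 2 ^ e) ∧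
    ∃ ψ : ι → G →* ℂˣ, (∀ i j, i ≠ j → ψ i (g j) = 1) ∧
      ∀ i, IsPrimitiveRoot (ψ i (g i)) (m i)

namespace IsDualizable

variable {G : Type*} [Group G] {ι : Type*} {g : ι → G} {m : ι → ℕ}

open scoped Classical in
/-- A generator may be multiplied by another one whose order divides its own. -/
lemma update_mul (h : IsDualizable g m) {j k : ι} (hjk : j ≠ k) (hdvd : m j ∣ m k)
    (hk : ∃ e, m k = 2 ^ e) : IsDualizable (Function.update g k (g k * g j)) m := by
  obtain ⟨hcl, hcen, ψ, hψ, hprim⟩ := h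
  refine ⟨?_, fun i hi => ?_, ?_⟩
  · rw [eq_top_iff, ← hcl, Subgroup.closure_le]
    rintro _ ⟨i, rfl⟩
    have hin : ∀ i, Function.update g k (g k * g j) i ∈
        Subgroup.closure (Set.range (Function.update g k (g k * g j))) :=
      fun i => Subgroup.subset_closure ⟨i, rfl⟩
    by_cases hi : i = k
    · have h1 := hin k
      have h2 := hin j
      rw [Function.update_self] at h1
      rw [Function.update_of_ne hjk] at h2
      have := Subgroup.mul_mem _ h1 (Subgroup.inv_mem _ h2)
      rw [mul_inv_cancel_right] at this
      exact hi ▸ this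
    · have := hin i
      rwa [Function.update_of_ne hi] at this
  · by_cases hik : i = k
    · exact hik ▸ hk
    · rw [Function.update_of_ne hik] at hi
      exact hcen i hi
  · -- `ψ j` times this power of `ψ k` is trivial on `g k * g j`
    obtain ⟨a, ha⟩ : ∃ a : ℕ, ψ k (g k) ^ a = (ψ j (g j))⁻¹ := by
      have : NeZero (m k) := by
        obtain ⟨e, he⟩ := hk
        exact ⟨by rw [he]; positivity⟩
      have h1 : ((ψ j (g j))⁻¹ : ℂˣ) ^ m k = 1 := by
        obtain ⟨c, hc⟩ := hdvd
        rw [hc, pow_mul, inv_pow, (hprim j).pow_eq_one, inv_one, one_pow]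
      obtain ⟨a, -, ha⟩ := (IsPrimitiveRoot.coe_units_iff.2 (hprim k)).eq_pow_of_pow_eq_one
        (ξ := (((ψ j (g j))⁻¹ : ℂˣ) : ℂ)) (by rw [← Units.val_pow_eq_pow_val, h1, Units.val_one])
      exact ⟨a, Units.ext (by rw [Units.val_pow_eq_pow_val, ha])⟩
    refine ⟨Function.update ψ j (ψ j * ψ k ^ a), fun i l hil => ?_, fun i => ?_⟩
    · by_cases hi : i = j
      · subst hi
        rw [Function.update_self]
        by_cases hl : l = k
        · subst hl
          rw [Function.update_self, MonoidHom.mul_apply, MonoidHom.pow_apply, map_mul, map_mul,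
            hψ i l hjk, hψ l i hjk.symm, one_mul, mul_one, ha, mul_inv_cancel]
        · rw [Function.update_of_ne hl, MonoidHom.mul_apply, MonoidHom.pow_apply, hψ i l hil,
            hψ k l (Ne.symm hl), one_pow, one_mul]
      · rw [Function.update_of_ne hi]
        by_cases hl : l = k
        · subst hl
          rw [Function.update_self, map_mul, hψ i l hil, hψ i j hi, one_mul]
        · rw [Function.update_of_ne hl, hψ i l hil]
    · by_cases hi : i = j
      · subst hi
        rw [Function.update_self, Function.update_of_ne hjk, MonoidHom.mul_apply,
          MonoidHom.pow_apply, hψ k i hjk.symm, one_pow, mul_one]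
        exact hprim i
      · rw [Function.update_of_ne hi]
        by_cases hik : i = k
        · subst hik
          rw [Function.update_self, map_mul, hψ i j hi, mul_one]
          exact hprim i
        · rw [Function.update_of_ne hik]
          exact hprim i

open scoped Classical in
lemma mul_on (h : IsDualizable g m) {j : ι} (K : Finset ι) (hj : j ∉ K)
    (hdvd : ∀ k ∈ K, m j ∣ m k) (hk : ∀ k ∈ K, ∃ e, m k = 2 ^ e) :
    IsDualizable (fun k => if k ∈ K then g k * g j else g k) m := by
  induction K using Finset.induction_on with
  | empty => simpa using h
  | insert a K ha ih =>
    rw [Finset.mem_insert, not_or] at hj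
    have h1 := ih hj.2 (fun k hk' => hdvd k (Finset.mem_insert_of_mem hk'))
      (fun k hk' => hk k (Finset.mem_insert_of_mem hk'))
    have h2 := h1.update_mul hj.1 (hdvd a (Finset.mem_insert_self _ _))
      (hk a (Finset.mem_insert_self _ _))
    convert h2 using 1
    funext k
    by_cases hka : k = a
    · subst hka
      simp [ha, hj.2]
    · rw [Function.update_of_ne hka]
      simp [hka]

/-- Every noncommuting pair with one index in `S` lies in `S`, and no index in `S` belongs to
two such pairs. -/
def MatchedOn (g : ι → G) (S : Finset ι) : Prop :=
  ∀ i ∈ S, ∀ j, ¬ Commute (g i) (g j) → j ∈ S ∧ ∀ k, ¬ Commute (g i) (g k) → k = j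

/-- A dualizable family can be changed into one in which every generator fails to commute with
at most one other. This is the normal form of an alternating form over `𝔽₂` under the changes of
basis that add basis vectors to those of larger order: a pair with nonzero pairing and
smallest possible orders can be split off orthogonally. -/
lemma exists_matchedOn [Fintype ι] {z : G} (hz : IsCommutatorGenerator z) (n : ℕ) :
    ∀ (g : ι → G) (S : Finset ι), IsDualizable g m → MatchedOn g S → Fintype.card ι ≤ S.card + n →
      ∃ g' : ι → G, IsDualizable g' m ∧ MatchedOn g' Finset.univ := by
  classical
  induction n with
  | zero =>
    intro g S hg hS hc
    refine ⟨g, hg, ?_⟩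
    have : S = Finset.univ := Finset.eq_univ_of_card S (le_antisymm S.card_le_univ hc)
    rwa [this] at hS
  | succ n ih =>
    intro g S hg hS hc
    let R : Finset ι := {i | i ∉ S ∧ ∃ j, ¬ Commute (g i) (g j)}
    by_cases hR : R.Nonempty
    swap
    · refine ⟨g, hg, fun i _ j hij => ?_⟩
      have hiS : i ∈ S := by
        by_contra hi
        exact hR ⟨i, by simpa [R] using ⟨hi, j, hij⟩⟩
      exact ⟨Finset.mem_univ _, (hS i hiS j hij).2⟩
    have hRpow : ∀ i, (∃ j, ¬ Commute (g i) (g j)) → ∃ e, m i = 2 ^ e :=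
      fun i ⟨j, hij⟩ => hg.2.1 i ⟨_, hij⟩
    have hdvd : ∀ i j, (∃ k, ¬ Commute (g i) (g k)) → (∃ k, ¬ Commute (g j) (g k)) →
        m i ≤ m j → m i ∣ m j := by
      intro i j hi hj hle
      obtain ⟨a, ha⟩ := hRpow i hi
      obtain ⟨b, hb⟩ := hRpow j hj
      rw [ha, hb] at hle ⊢
      exact pow_dvd_pow 2 ((Nat.pow_le_pow_iff_right (by norm_num)).1 hle)
    obtain ⟨i, hiR, himin⟩ := R.exists_min_image m hR
    obtain ⟨hiS, hinc⟩ : i ∉ S ∧ ∃ j, ¬ Commute (g i) (g j) := by simpa [R] using hiR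
    let T : Finset ι := {j | ¬ Commute (g i) (g j)}
    have memT : ∀ j, j ∈ T ↔ ¬ Commute (g i) (g j) := fun j => by simp [T]
    obtain ⟨j, hjT, hjmin⟩ := T.exists_min_image m
      (by obtain ⟨j, hj⟩ := hinc; exact ⟨j, (memT j).2 hj⟩)
    have hij : ¬ Commute (g i) (g j) := (memT j).1 hjT
    -- elements of `S` commute with everything outside `S`
    have hSout : ∀ l ∈ S, ∀ k, k ∉ S → Commute (g l) (g k) := fun l hl k hk => by
      by_contra hlk
      exact hk (hS l hl k hlk).1
    have hjS : j ∉ S := fun hj => hij (hSout j hj i hiS).symm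
    have hiT : i ∉ T := fun hi => (memT i).1 hi (Commute.refl _)
    have hne : i ≠ j := fun e => hiT (e ▸ hjT)
    -- make `g i` commute with everything but `g j`
    let K₁ : Finset ι := T.erase j
    let g₁ : ι → G := fun k => if k ∈ K₁ then g k * g j else g k
    have hg₁ : IsDualizable g₁ m := by
      refine hg.mul_on K₁ (Finset.notMem_erase j T) (fun k hk => ?_) (fun k hk => ?_)
      · have hkT := Finset.mem_of_mem_erase hk
        exact hdvd j k ⟨i, fun e => hij e.symm⟩ ⟨i, fun e => (memT k).1 hkT e.symm⟩ (hjmin k hkT)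
      · exact hRpow k ⟨i, fun e => (memT k).1 (Finset.mem_of_mem_erase hk) e.symm⟩
    have hg₁i : g₁ i = g i := if_neg fun h => hiT (Finset.mem_of_mem_erase h)
    have hg₁j : g₁ j = g j := if_neg (Finset.notMem_erase j T)
    have hg₁S : ∀ l ∈ S, g₁ l = g l := fun l hl =>
      if_neg fun h => (memT l).1 (Finset.mem_of_mem_erase h) (hSout l hl i hiS).symm
    have hs₁ : ∀ k ≠ j, csign (g i) (g₁ k) = 1 := by
      intro k hk
      by_cases hkT : k ∈ T
      · have : g₁ k = g k * g j := if_pos (Finset.mem_erase.2 ⟨hk, hkT⟩)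
        rw [this, hz.csign_mul, csign_of_not_commute ((memT k).1 hkT), csign_of_not_commute hij]
        norm_num
      · have : g₁ k = g k := if_neg fun h => hkT (Finset.mem_of_mem_erase h)
        rw [this, csign_eq_one_iff]
        by_contra hc
        exact hkT ((memT k).2 hc)
    -- make `g j` commute with everything but `g i`
    let K₂ : Finset ι := {k | k ≠ i ∧ ¬ Commute (g j) (g₁ k)}
    have memK₂ : ∀ k, k ∈ K₂ ↔ k ≠ i ∧ ¬ Commute (g j) (g₁ k) := fun k => by simp [K₂]
    let g₂ : ι → G := fun k => if k ∈ K₂ then g₁ k * g₁ i else g₁ k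
    have hK₂S : ∀ l ∈ S, l ∉ K₂ := fun l hl h => by
      have := ((memK₂ l).1 h).2
      rw [hg₁S l hl] at this
      exact this (hSout l hl j hjS).symm
    have hK₂R : ∀ k ∈ K₂, k ∈ R := by
      intro k hk
      have hkS : k ∉ S := fun h => hK₂S k h hk
      by_cases hkT : k ∈ T
      · simpa [R] using ⟨hkS, i, fun e => (memT k).1 hkT e.symm⟩
      · have hgk : g₁ k = g k := if_neg fun h => hkT (Finset.mem_of_mem_erase h)
        have := ((memK₂ k).1 hk).2
        rw [hgk] at this
        simpa [R] using ⟨hkS, j, fun e => this e.symm⟩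
    have hg₂ : IsDualizable g₂ m := by
      refine hg₁.mul_on K₂ (fun h => ((memK₂ i).1 h).1 rfl) (fun k hk => ?_) (fun k hk => ?_)
      · have hkR := hK₂R k hk
        have hkn : k ∉ S ∧ ∃ j, ¬ Commute (g k) (g j) := by simpa [R] using hkR
        exact hdvd i k hinc hkn.2 (himin k hkR)
      · have hkn : k ∉ S ∧ ∃ j, ¬ Commute (g k) (g j) := by simpa [R] using hK₂R k hk
        exact hRpow k hkn.2
    have hg₂i : g₂ i = g i := (if_neg fun h => ((memK₂ i).1 h).1 rfl).trans hg₁i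
    have hg₂j : g₂ j = g j :=
      (if_neg fun h => ((memK₂ j).1 h).2 (by rw [hg₁j])).trans hg₁j
    have hg₂S : ∀ l ∈ S, g₂ l = g l := fun l hl => (if_neg (hK₂S l hl)).trans (hg₁S l hl)
    have hsS : ∀ l ∈ S, ∀ k, csign (g l) (g₂ k) = csign (g l) (g k) := by
      intro l hl k
      have e1 : csign (g l) (g₁ k) = csign (g l) (g k) := by
        by_cases hk : k ∈ K₁
        · rw [show g₁ k = g k * g j from if_pos hk, hz.csign_mul,
            csign_eq_one_iff.2 (hSout l hl j hjS), mul_one]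
        · rw [show g₁ k = g k from if_neg hk]
      by_cases hk : k ∈ K₂
      · rw [show g₂ k = g₁ k * g₁ i from if_pos hk, hz.csign_mul, e1, hg₁i,
          csign_eq_one_iff.2 (hSout l hl i hiS), mul_one]
      · rw [show g₂ k = g₁ k from if_neg hk, e1]
    have hsi : ∀ k ≠ j, csign (g i) (g₂ k) = 1 := by
      intro k hk
      by_cases hk2 : k ∈ K₂
      · rw [show g₂ k = g₁ k * g₁ i from if_pos hk2, hz.csign_mul, hs₁ k hk, hg₁i, csign_self,
          one_mul]
      · rw [show g₂ k = g₁ k from if_neg hk2, hs₁ k hk]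
    have hsj : ∀ k ≠ i, csign (g j) (g₂ k) = 1 := by
      intro k hk
      by_cases hk2 : k ∈ K₂
      · rw [show g₂ k = g₁ k * g₁ i from if_pos hk2, hz.csign_mul,
          csign_of_not_commute ((memK₂ k).1 hk2).2, hg₁i,
          csign_of_not_commute (fun e => hij e.symm)]
        norm_num
      · rw [show g₂ k = g₁ k from if_neg hk2, csign_eq_one_iff]
        by_contra hc
        exact hk2 ((memK₂ k).2 ⟨hk, hc⟩)
    refine ih g₂ (insert i (insert j S)) hg₂ ?_ ?_
    · intro l hl k hlk
      rw [Finset.mem_insert, Finset.mem_insert] at hl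
      rcases hl with rfl | rfl | hl
      · rw [hg₂i] at hlk ⊢
        have honly : ∀ k', ¬ Commute (g l) (g₂ k') → k' = j := fun k' hk' => by
          by_contra hne'
          exact hk' (csign_eq_one_iff.1 (hsi k' hne'))
        exact ⟨by simp [honly k hlk], fun k' hk' => (honly k' hk').trans (honly k hlk).symm⟩
      · rw [hg₂j] at hlk ⊢
        have honly : ∀ k', ¬ Commute (g l) (g₂ k') → k' = i := fun k' hk' => by
          by_contra hne'
          exact hk' (csign_eq_one_iff.1 (hsj k' hne'))
        exact ⟨by simp [honly k hlk], fun k' hk' => (honly k' hk').trans (honly k hlk).symm⟩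
      · have hiff : ∀ k', Commute (g₂ l) (g₂ k') ↔ Commute (g l) (g k') := fun k' => by
          rw [hg₂S l hl, ← csign_eq_one_iff, hsS l hl, csign_eq_one_iff]
        rw [hiff] at hlk
        obtain ⟨hkS, hun⟩ := hS l hl k hlk
        exact ⟨by simp [hkS], fun k' hk' => hun k' (by rwa [hiff] at hk')⟩
    · have : S.card < (insert i (insert j S)).card :=
        Finset.card_lt_card (Finset.ssubset_iff_of_subset (fun a ha => by simp [ha]) |>.2
          ⟨i, by simp, hiS⟩)
      omega

end IsDualizable

/-- The generators supplied by the structure theorem for finite abelian groups, applied to the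
abelianization. -/
lemma exists_isDualizable {G : Type*} [Group G] [Finite G] {z : G} (hz : IsCommutatorGenerator z)
    (hc : commutator G ≤ Subgroup.center G) :
    ∃ (ι : Type) (_ : Fintype ι) (g : ι → G) (m : ι → ℕ), (∀ i, 1 < m i) ∧ IsDualizable g m := by
  classical
  obtain ⟨κ, _, p, hp, e, ⟨f⟩⟩ :=
    AddCommGroup.equiv_directSum_zmod_of_finite (Additive (Abelianization G))
  let ι : Type := {i : κ // e i ≠ 0}
  let m : ι → ℕ := fun i => p i ^ e i
  have hm : ∀ i, 1 < m i := fun i => one_lt_pow₀ (hp i).one_lt i.2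
  let b : κ → Additive (Abelianization G) := fun i =>
    f.symm (DirectSum.of (fun i => ZMod (p i ^ e i)) i 1)
  have hb : ∀ i : κ, ∃ x : G, Abelianization.of x = (b i).toMul := fun i =>
    QuotientGroup.mk_surjective _
  choose x hx using hb
  let g : ι → G := fun i => x i
  refine ⟨ι, inferInstance, g, m, hm, ?_, ?_, ?_⟩
  · refine eq_top_of_forall_exists_mul_commutator hc fun y => ?_
    -- it suffices to generate the abelianization
    have key : ∀ u : DirectSum κ fun i => ZMod (p i ^ e i), ∃ h ∈ Subgroup.closure (Set.range g),
        f (Additive.ofMul (Abelianization.of h)) = u := by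
      intro u
      induction u using DirectSum.induction_on with
      | zero => exact ⟨1, one_mem _, by simp⟩
      | of i c =>
        by_cases hi : e i = 0
        · refine ⟨1, one_mem _, ?_⟩
          have : Subsingleton (ZMod (p i ^ e i)) := by rw [hi, pow_zero]; infer_instance
          rw [Subsingleton.elim c 0]
          simp
        · have : NeZero (p i ^ e i) := ⟨pow_ne_zero _ (hp i).ne_zero⟩
          refine ⟨g ⟨i, hi⟩ ^ c.val,
            Subgroup.pow_mem _ (Subgroup.subset_closure (Set.mem_range_self _)) _, ?_⟩
          rw [map_pow, hx, ofMul_pow, map_nsmul]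
          simp only [b, ofMul_toMul, AddEquiv.apply_symm_apply]
          rw [← map_nsmul, nsmul_one, ZMod.natCast_zmod_val]
      | add u v hu hv =>
        obtain ⟨h, hh, rfl⟩ := hu
        obtain ⟨k, hk, rfl⟩ := hv
        exact ⟨h * k, mul_mem hh hk, by rw [map_mul, ofMul_mul, map_add]⟩
    obtain ⟨h, hh, hf⟩ := key (f (Additive.ofMul (Abelianization.of y)))
    refine ⟨h, hh, h⁻¹ * y, ?_, by group⟩
    rw [← Abelianization.ker_of, MonoidHom.mem_ker, map_mul, map_inv]
    have := f.injective hf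
    rw [Additive.ofMul.injective this, inv_mul_cancel]
  · rintro i ⟨h, hih⟩
    by_contra hne
    refine hih (hz.commute_of_odd (n := m i) ?_ (hc ?_) h)
    · refine Odd.pow ((hp i).odd_of_ne_two fun h2 => hne ⟨e i, ?_⟩)
      simp only [m, h2]
    · rw [← Abelianization.ker_of, MonoidHom.mem_ker, map_pow, hx]
      change m i • b i = 0
      rw [← map_nsmul, ← map_nsmul, nsmul_one, show (m i : ZMod (p i ^ e i)) = 0 from
        ZMod.natCast_self _, map_zero, map_zero]
  · have hζ : ∀ i, ∃ ζ : ℂˣ, IsPrimitiveRoot ζ (m i) := fun i => by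
      have hne : m i ≠ 0 := by have := hm i; omega
      have h1 := Complex.isPrimitiveRoot_exp (m i) hne
      exact ⟨(h1.isUnit hne).unit, IsPrimitiveRoot.coe_units_iff.1 h1⟩
    choose ζ hζ using hζ
    let χ : ∀ i : ι, ZMod (p i ^ e i) →+ Additive ℂˣ := fun i =>
      (MonoidHom.toAdditive (Subgroup.zpowers (ζ i)).subtype).comp
        (hζ i).zmodEquivZPowers.toAddMonoidHom
    have hχ : ∀ i, (χ i 1).toMul = ζ i := fun i => by
      have := (hζ i).zmodEquivZPowers_apply_coe_nat 1
      simp only [Nat.cast_one, pow_one] at this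
      simp only [χ, AddMonoidHom.comp_apply]
      erw [this]
      rfl
    let Ψ : ∀ i : ι, Additive (Abelianization G) →+ Additive ℂˣ := fun i =>
      (χ i).comp ((DirectSum.component ℤ κ (fun i => ZMod (p i ^ e i)) i).toAddMonoidHom.comp
        f.toAddMonoidHom)
    have hΨ : ∀ (i j : ι), Ψ i (b j) = χ i (DirectSum.of (fun i => ZMod (p i ^ e i)) j 1 i) :=
      fun i j => by
        simp only [Ψ, b, AddMonoidHom.comp_apply]
        erw [AddEquiv.apply_symm_apply]
        rfl
    refine ⟨fun i => (MonoidHom.toAdditive.symm (Ψ i)).comp Abelianization.of,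
      fun i j hij => ?_, fun i => ?_⟩
    · change (Ψ i (Additive.ofMul (Abelianization.of (g j)))).toMul = 1
      rw [hx, ofMul_toMul, hΨ, DirectSum.of_eq_of_ne _ _ _ (fun h => hij (Subtype.ext h)),
        map_zero, toMul_zero]
    · change IsPrimitiveRoot (Ψ i (Additive.ofMul (Abelianization.of (g i)))).toMul (m i)
      rw [hx, ofMul_toMul, hΨ, DirectSum.of_eq_same, hχ]
      exact hζ i

/-- The data from which the Yetter-Drinfel'd module is built: a family of generators, each of which
fails to commute with at most one other, and dual characters taking the value `-1` on the
noncentral generators and a nontrivial root of unity on the central ones. -/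
structure IsMatchedFamily {G : Type*} [Group G] {ι : Type*} (g : ι → G) (χ : ι → G →* ℂˣ) :
    Prop where
  closure_eq_top : Subgroup.closure (Set.range g) = ⊤
  apply_of_ne : ∀ i j, i ≠ j → χ i (g j) = 1
  apply_self_ne_one : ∀ i, χ i (g i) ≠ 1
  apply_self_pow : ∀ i, ∃ N ≠ 0, χ i (g i) ^ N = 1
  apply_self_of_not_commute : ∀ i h, ¬ Commute (g i) h → χ i (g i) = -1
  existsUnique_not_commute : ∀ i h, ¬ Commute (g i) h → ∃! j, ¬ Commute (g i) (g j)

lemma exists_isMatchedFamily {G : Type*} [Group G] [Finite G]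
    {z : G} (hz : IsCommutatorGenerator z) (hc : commutator G ≤ Subgroup.center G) :
    ∃ (ι : Type) (_ : Finite ι) (g : ι → G) (χ : ι → G →* ℂˣ), IsMatchedFamily g χ := by
  classical
  obtain ⟨ι, _, g₀, m, hm, hg₀⟩ := exists_isDualizable hz hc
  obtain ⟨g, ⟨hcl, hpow, ψ, hψ, hprim⟩, hmatch⟩ := IsDualizable.exists_matchedOn hz
    (Fintype.card ι) g₀ ∅ hg₀ (fun i hi => absurd hi (Finset.notMem_empty i)) (by simp)
  have hχ : ∀ i, ∃ n : ℕ, (ψ i (g i)) ^ n ≠ 1 ∧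
      ∀ h, ¬ Commute (g i) h → (ψ i (g i)) ^ n = -1 := by
    intro i
    by_cases hi : ∃ h, ¬ Commute (g i) h
    · obtain ⟨e, he⟩ := hpow i hi
      have he0 : e ≠ 0 := by
        rintro rfl
        have := hm i
        omega
      obtain ⟨e, rfl⟩ := Nat.exists_eq_succ_of_ne_zero he0
      have h2 : IsPrimitiveRoot (ψ i (g i) ^ 2 ^ e) 2 :=
        (hprim i).pow (by rw [he]; positivity) (by rw [he, Nat.succ_eq_add_one, pow_succ])
      have h3 := (IsPrimitiveRoot.coe_units_iff.2 h2).eq_neg_one_of_two_right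
      exact ⟨2 ^ e, h2.ne_one (by norm_num), fun _ _ => Units.ext (by rw [h3]; simp)⟩
    · exact ⟨1, by rw [pow_one]; exact (hprim i).ne_one (hm i), fun h hh => absurd ⟨h, hh⟩ hi⟩
  choose n hn1 hn2 using hχ
  refine ⟨ι, inferInstance, g, fun i => ψ i ^ n i, hcl, fun i j hij => ?_, hn1, fun i => ?_,
    hn2, fun i h hih => ?_⟩
  · rw [MonoidHom.pow_apply, hψ i j hij, one_pow]
  · refine ⟨m i, by have := hm i; omega, ?_⟩
    rw [MonoidHom.pow_apply, pow_right_comm, (hprim i).pow_eq_one, one_pow]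
  · -- an element commuting with all generators is central
    obtain ⟨j, hj⟩ : ∃ j, ¬ Commute (g i) (g j) := by
      by_contra! hall
      refine hih ?_
      have hle : Subgroup.closure (Set.range g) ≤ Subgroup.centralizer {g i} := by
        rw [Subgroup.closure_le]
        rintro _ ⟨j, rfl⟩
        exact Subgroup.mem_centralizer_singleton_iff.2 (hall j).symm
      rw [hcl] at hle
      exact (Subgroup.mem_centralizer_singleton_iff.1 (hle (Subgroup.mem_top h))).symm
    exact ⟨j, hj, (hmatch i (Finset.mem_univ i) j hj).2⟩

/-! ### The Yetter-Drinfel'd module of a matched family of generators -/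

/-- The Yetter-Drinfel'd module with a homogeneous basis permuted by the group up to scalars:
`g` carries the basis vector `j` to `c g j` times the basis vector `perm g j`. -/
def YDModule.ofMonomial {G : Type*} [Group G] {J : Type*} (deg : J → G) (perm : G → J → J)
    (c : G → J → ℂ) (perm_one : ∀ j, perm 1 j = j)
    (perm_mul : ∀ g h j, perm (g * h) j = perm g (perm h j)) (c_one : ∀ j, c 1 j = 1)
    (c_mul : ∀ g h j, c (g * h) j = c h j * c g (perm h j))
    (deg_perm : ∀ g j, deg (perm g j) = g * deg j * g⁻¹) : YDModule G (J →₀ ℂ) :=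
  let act : Representation ℂ G (J →₀ ℂ) :=
    { toFun := fun g => Finsupp.linearCombination ℂ fun j => Finsupp.single (perm g j) (c g j)
      map_one' := by
        ext j : 2
        simp [perm_one, c_one]
      map_mul' := fun g h => by
        ext j : 2
        simp [perm_mul, c_mul, Module.End.mul_apply] }
  have act_le : ∀ g h, (Finsupp.supported ℂ ℂ {j | deg j = h}).map (act g) ≤
      Finsupp.supported ℂ ℂ {j | deg j = g * h * g⁻¹} := by
    intro g h
    rw [Finsupp.supported_eq_span_single, Submodule.map_span, Submodule.span_le]
    rintro _ ⟨_, ⟨j, hj, rfl⟩, rfl⟩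
    have : act g (Finsupp.single j 1) = Finsupp.single (perm g j) (c g j) := by simp [act]
    rw [this]
    refine Finsupp.single_mem_supported ℂ _ ?_
    change deg (perm g j) = _
    rw [deg_perm, show deg j = h from hj]
  { act := act
    grade := fun g => Finsupp.supported ℂ ℂ {j | deg j = g}
    grade_iSupIndep := by
      intro g
      have hle : (⨆ h, ⨆ _ : h ≠ g, Finsupp.supported ℂ ℂ {j | deg j = h}) ≤
          Finsupp.supported ℂ ℂ {j | deg j ≠ g} :=
        iSup₂_le fun h hh => Finsupp.supported_mono fun j hj hj' =>
          hh ((show deg j = h from hj).symm.trans hj')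
      refine Disjoint.mono_right hle (Finsupp.disjoint_supported_supported ?_)
      exact Set.disjoint_left.2 fun j hj hj' => hj' hj
    grade_iSup := by
      rw [← Finsupp.supported_iUnion, Set.iUnion_eq_univ_iff.2 fun j => ⟨deg j, rfl⟩,
        Finsupp.supported_univ]
    act_grade := fun g h => by
      refine le_antisymm (act_le g h) fun v hv => ?_
      have h1 := act_le g⁻¹ (g * h * g⁻¹) ⟨v, hv, rfl⟩
      rw [show g⁻¹ * (g * h * g⁻¹) * g⁻¹⁻¹ = h by group] at h1
      refine ⟨_, h1, ?_⟩
      rw [← Module.End.mul_apply, ← map_mul, mul_inv_cancel, map_one, Module.End.one_apply] }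

namespace IsMatchedFamily

variable {G : Type*} [Group G] {ι : Type} {g : ι → G} {χ : ι → G →* ℂˣ}

variable (g) in
/-- The noncentral generators. -/
abbrev Noncentral : Type := {i : ι // ∃ h, ¬ Commute (g i) h}

variable (g) in
/-- The central generators. -/
abbrev Cent : Type := {i : ι // ¬ ∃ h, ¬ Commute (g i) h}

variable (g) in
/-- The index set of the basis: two elements for the conjugacy class `{g i, z g i}` of each
noncentral generator and one element for each central generator. -/
abbrev Idx : Type := Noncentral g × Bool ⊕ Cent g

variable (g) in
/-- The generator to which an index belongs. -/
def gen : Idx g → ι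
  | .inl (i, _) => i.1
  | .inr k => k.1

variable (g) in
/-- The degree of a basis vector. -/
def deg (z : G) : Idx g → G
  | .inl (i, s) => if s then z * g i else g i
  | .inr k => g k

open scoped Classical in
variable (g) in
/-- The permutation of the basis vectors by conjugation of their degrees. -/
def perm (h : G) : Idx g → Idx g
  | .inl (i, s) => .inl (i, xor s (!decide (Commute h (g i))))
  | .inr k => .inr k

variable {z : G} (hz : IsCommutatorGenerator z)

include hz in
/-- The multiplicativity of the commutator form, written additively with Boolean values. -/
lemma decide_commute_mul (a h k : G) [∀ x y : G, Decidable (Commute x y)] :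
    (!decide (Commute (h * k) a)) = xor (!decide (Commute k a)) (!decide (Commute h a)) := by
  have e := hz.csign_mul a h k
  have e1 : ∀ x, decide (Commute x a) = true ↔ csign a x = 1 := fun x => by
    rw [decide_eq_true_iff, csign_eq_one_iff]; exact ⟨Commute.symm, Commute.symm⟩
  have e2 : ∀ x, decide (Commute x a) = false → csign a x = -1 := fun x hx => by
    rw [decide_eq_false_iff_not] at hx
    exact csign_of_not_commute fun h => hx h.symm
  rcases h1 : decide (Commute h a) with _ | _ <;> rcases h2 : decide (Commute k a) with _ | _ <;>
    rcases h3 : decide (Commute (h * k) a) with _ | _ <;> first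
    | rfl
    | (exfalso
       first | rw [(e1 _).1 h1] at e | rw [e2 _ h1] at e
       first | rw [(e1 _).1 h2] at e | rw [e2 _ h2] at e
       first | rw [(e1 _).1 h3] at e | rw [e2 _ h3] at e
       norm_num at e)

variable (g χ) in
include hz in
/-- The Yetter-Drinfel'd module of a matched family: the sum over the generators `g i` of the
modules spanned by the conjugacy class of `g i`, on which `G` acts by conjugation twisted by the
character `χ i`. -/
def ydModule : YDModule G (Idx g →₀ ℂ) := by
  classical
  exact YDModule.ofMonomial (deg g z) (perm g) (fun h j => χ (gen g j) h)
    (by rintro (⟨i, s⟩ | k) <;> simp [perm])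
    (by
      rintro h k (⟨i, s⟩ | j)
      · simp only [perm]
        rw [decide_commute_mul hz, Bool.xor_assoc]
      · rfl)
    (by intro j; simp)
    (by rintro h k (⟨i, s⟩ | j) <;> simp [gen, perm, mul_comm])
    (by
      rintro h (⟨i, s⟩ | j)
      · by_cases hc : Commute h (g i)
        · have e : h * g i * h⁻¹ = g i := by rw [hc.eq, mul_inv_cancel_right]
          cases s
          · simp [deg, perm, hc, e]
          · simp only [deg, perm, hc, decide_true, Bool.not_true, Bool.xor_false, if_true]
            rw [← mul_assoc, ← hz.mul_comm, mul_assoc, mul_assoc, ← mul_assoc h, e]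
        · have e : h * g i * h⁻¹ = z * g i := by
            rw [(hz.mul_eq h (g i)).resolve_left hc, mul_assoc, mul_inv_cancel_right]
          cases s
          · simp [deg, perm, hc, e]
          · simp only [deg, perm, hc, decide_false, Bool.not_false, Bool.xor_true, Bool.not_true,
              if_true, Bool.false_eq_true, if_false]
            rw [← mul_assoc, ← hz.mul_comm, mul_assoc, mul_assoc, ← mul_assoc h, e, ← mul_assoc,
              hz.mul_self, one_mul]
      · have hc : Commute (g j) h := by
          by_contra hc
          exact j.2 ⟨h, hc⟩
        simp only [deg, perm]
        rw [← hc.eq, mul_inv_cancel_right])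

open scoped Classical in
lemma ydModule_act_single (h : G) (j : Idx g) (c : ℂ) :
    (ydModule g χ hz).act h (Finsupp.single j c) =
      Finsupp.single (perm g h j) (c * χ (gen g j) h) := by
  change Finsupp.linearCombination ℂ _ (Finsupp.single j c) = _
  rw [Finsupp.linearCombination_single, Finsupp.smul_single, smul_eq_mul]

lemma single_mem_grade (j : Idx g) (c : ℂ) :
    Finsupp.single j c ∈ (ydModule g χ hz).grade (deg g z j) :=
  Finsupp.single_mem_supported ℂ _ (show deg g z j = deg g z j from rfl)

lemma isIndecomposable_ydModule (h : IsMatchedFamily g χ) :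
    (ydModule g χ hz).IsIndecomposable := by
  unfold YDModule.IsIndecomposable
  rw [eq_top_iff, ← h.closure_eq_top]
  refine Subgroup.closure_mono ?_
  have key : ∀ j : Idx g, (ydModule g χ hz).grade (deg g z j) ≠ ⊥ := fun j hj => by
    have := single_mem_grade (χ := χ) hz j 1
    rw [hj, Submodule.mem_bot, Finsupp.single_eq_zero] at this
    exact one_ne_zero this
  rintro _ ⟨i, rfl⟩
  by_cases hi : ∃ h, ¬ Commute (g i) h
  · exact key (.inl (⟨i, hi⟩, false))
  · exact key (.inr ⟨i, hi⟩)

variable (g) in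
/-- The basis of eigenvectors: `v ± v'` for the two basis vectors `v`, `v'` that belong to
a noncentral generator. -/
def eigenvector : Idx g → (Idx g →₀ ℂ)
  | .inl (i, s) => Finsupp.single (.inl (i, false)) 1 +
      Finsupp.single (.inl (i, true)) (if s then -1 else 1)
  | .inr k => Finsupp.single (.inr k) 1

variable (g χ) in
/-- The character by which `G` acts on an eigenvector. -/
def eigenvalue (h : G) : Idx g → ℂ
  | .inl (i, s) => χ i h * if s then csign h (g i) else 1
  | .inr k => χ k h

lemma act_eigenvector (h : G) (j : Idx g) :
    (ydModule g χ hz).act h (eigenvector g j) = eigenvalue g χ h j • eigenvector g j := by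
  classical
  rcases j with ⟨i, s⟩ | k
  · simp only [eigenvector, eigenvalue, map_add, ydModule_act_single, perm, gen]
    by_cases hc : Commute h (g i)
    · rw [csign_eq_one_iff.2 hc]
      cases s <;> simp [hc]
    · rw [csign_of_not_commute hc]
      cases s <;> simp [hc, add_comm]
  · simp [eigenvector, eigenvalue, ydModule_act_single, perm, gen]

include hz in
/-- The commutators act trivially on the eigenvectors. -/
lemma eigenvalue_mul {i : ι} (hi : ∃ h, ¬ Commute (g i) h) (h : G) (j : Idx g) :
    eigenvalue g χ (z * h) j = eigenvalue g χ h j := by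
  obtain ⟨k, hk⟩ := hi
  have hχ : ∀ φ : G →* ℂˣ, φ z = 1 := fun φ => by
    have e := congrArg φ ((hz.mul_eq (g i) k).resolve_left hk)
    rw [map_mul, map_mul, map_mul, mul_comm (φ k)] at e
    exact (mul_eq_right.1 e.symm)
  have hcs : ∀ a, csign (z * h) a = csign h a := fun a => by
    rw [csign_comm, hz.csign_mul, csign_eq_one_iff.2 (show Commute a z from (hz.mul_comm a).symm),
      one_mul, csign_comm]
  rcases j with ⟨i', s⟩ | k' <;> simp [eigenvalue, hχ, hcs]

lemma isDiagonal_ydModule : (ydModule g χ hz).IsDiagonal (eigenvector g)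
    (fun j k => eigenvalue g χ (g (gen g j)) k) where
  span_eq_top := by
    rw [eq_top_iff, ← Finsupp.supported_univ (M := ℂ) (R := ℂ), Finsupp.supported_eq_span_single,
      Submodule.span_le]
    have hm : ∀ j, eigenvector g j ∈ Submodule.span ℂ (Set.range (eigenvector g)) :=
      fun j => Submodule.subset_span ⟨j, rfl⟩
    rintro _ ⟨(⟨i, s⟩ | k), -, rfl⟩
    · have h1 := hm (.inl (i, false))
      have h2 := hm (.inl (i, true))
      cases s
      · have e : (Finsupp.single (.inl (i, false)) 1 : Idx g →₀ ℂ) =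
            (2⁻¹ : ℂ) • (eigenvector g (.inl (i, false)) + eigenvector g (.inl (i, true))) := by
          simp only [eigenvector, if_true, Bool.false_eq_true, if_false, Finsupp.single_neg]
          module
        simp only [e]
        exact Submodule.smul_mem _ _ (add_mem h1 h2)
      · have e : (Finsupp.single (.inl (i, true)) 1 : Idx g →₀ ℂ) =
            (2⁻¹ : ℂ) • (eigenvector g (.inl (i, false)) - eigenvector g (.inl (i, true))) := by
          simp only [eigenvector, if_true, Bool.false_eq_true, if_false, Finsupp.single_neg]
          module
        simp only [e]
        exact Submodule.smul_mem _ _ (sub_mem h1 h2)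
    · exact hm (.inr k)
  act_eq := by
    intro l j k hl
    have hdeg : ∀ j' c, l.1.2 (Finsupp.single j' c) ≠ 0 → l.1.1 = deg g z j' := by
      intro j' c hne
      by_contra hd
      exact hne (l.2 _ (Ne.symm hd) _ (single_mem_grade hz j' c))
    rw [act_eigenvector]
    congr 1
    rcases j with ⟨i, s⟩ | k'
    · rw [eigenvector, map_add] at hl
      by_cases h0 : l.1.2 (Finsupp.single (.inl (i, false)) 1) = 0
      · rw [h0, zero_add] at hl
        rw [hdeg _ _ hl]
        simp only [deg, gen, if_true]
        exact eigenvalue_mul hz i.2 _ _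
      · rw [hdeg _ _ h0]
        simp [deg, gen]
    · rw [hdeg _ _ hl]
      rfl

variable (h : IsMatchedFamily g χ)

include h

lemma existsUnique_partner (i : Noncentral g) : ∃! j : Noncentral g, ¬ Commute (g i) (g j) := by
  obtain ⟨a, ha⟩ := i.2
  obtain ⟨j, hj, hun⟩ := h.existsUnique_not_commute i a ha
  exact ⟨⟨j, _, fun e => hj e.symm⟩, hj, fun k hk => Subtype.ext (hun k hk)⟩

/-- The index that is linked to a given one in the Dynkin diagram; it is the given
index for a central generator. -/
def partner : Idx g → Idx g
  | .inl (i, s) => .inl ((h.existsUnique_partner i).choose, !s)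
  | .inr k => .inr k

lemma not_commute_choose (i : Noncentral g) :
    ¬ Commute (g i) (g (h.existsUnique_partner i).choose) :=
  (h.existsUnique_partner i).choose_spec.1

lemma eq_choose {i j : Noncentral g} (hij : ¬ Commute (g i) (g j)) :
    j = (h.existsUnique_partner i).choose :=
  (h.existsUnique_partner i).choose_spec.2 j hij

lemma partner_partner (j : Idx g) : h.partner (h.partner j) = j := by
  rcases j with ⟨i, s⟩ | k
  · simp only [partner, Bool.not_not]
    rw [← h.eq_choose (fun e => h.not_commute_choose i e.symm)]
  · rfl

include hz in
/-- The Nichols algebra is finite-dimensional: a noncentral pair of generators contributes two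
copies of the Dynkin diagram of type `A₂` at `-1`, a central generator an isolated vertex. -/
lemma finiteDimensional_nicholsAlgebra [Finite ι] :
    FiniteDimensional ℂ (ydModule g χ hz).NicholsAlgebra := by
  have hne : ∀ i k : ι, i ≠ k → (χ i (g k) : ℂ) = 1 := fun i k hik => by
    rw [h.apply_of_ne i k hik, Units.val_one]
  have hneg : ∀ i : Noncentral g, (χ i (g i) : ℂ) = -1 := fun i => by
    obtain ⟨a, ha⟩ := i.2
    rw [h.apply_self_of_not_commute i a ha]
    simp
  have hself : ∀ j, eigenvalue g χ (g (gen g j)) j = χ (gen g j) (g (gen g j)) := by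
    rintro (⟨i, s⟩ | k)
    · simp [eigenvalue, gen, csign_self]
    · rfl
  refine (isDiagonal_ydModule hz).finiteDimensional h.partner h.partner_partner ?_ ?_ ?_ ?_
  · rintro (⟨i, s⟩ | k) (⟨i', s'⟩ | k') h1 h2
    · by_cases hi : i' = i
      · subst hi
        simp [eigenvalue, gen, csign_self, hneg]
      · have hi1 : i'.1 ≠ i.1 := fun e => hi (Subtype.ext e)
        simp only [eigenvalue, gen, hne _ _ hi1, hne _ _ hi1.symm, one_mul]
        by_cases hc : Commute (g i) (g i')
        · rw [csign_eq_one_iff.2 hc, csign_eq_one_iff.2 hc.symm]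
          simp
        · have hs : s' = s := by
            by_contra hs
            refine h2 ?_
            rw [partner, ← h.eq_choose hc]
            cases s <;> cases s' <;> simp_all
          rw [csign_of_not_commute hc, csign_of_not_commute fun e => hc e.symm, hs]
          cases s <;> simp
    · have hi1 : i.1 ≠ k'.1 := fun e => k'.2 (e ▸ i.2)
      have hc : Commute (g k') (g i) := by
        by_contra hc
        exact k'.2 ⟨_, hc⟩
      simp [eigenvalue, gen, hne _ _ hi1, hne _ _ hi1.symm, csign_eq_one_iff.2 hc]
    · have hi1 : i'.1 ≠ k.1 := fun e => k.2 (e ▸ i'.2)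
      have hc : Commute (g k) (g i') := by
        by_contra hc
        exact k.2 ⟨_, hc⟩
      simp [eigenvalue, gen, hne _ _ hi1, hne _ _ hi1.symm, csign_eq_one_iff.2 hc]
    · have hk : k.1 ≠ k'.1 := fun e => h1 (by rw [Subtype.ext e])
      simp [eigenvalue, gen, hne _ _ hk, hne _ _ hk.symm]
  · rintro (⟨i, s⟩ | k) hj
    · refine ⟨by rw [hself]; exact hneg i, ?_⟩
      have hc := h.not_commute_choose i
      have hi : (h.existsUnique_partner i).choose.1 ≠ i.1 := fun e =>
        hc (by rw [e])
      simp only [partner, eigenvalue, gen, hne _ _ hi, hne _ _ hi.symm, one_mul]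
      rw [csign_of_not_commute hc, csign_of_not_commute fun e => hc e.symm]
      cases s <;> simp
    · exact absurd rfl hj
  · intro j
    rw [hself, Ne, Units.val_eq_one]
    exact h.apply_self_ne_one _
  · intro j
    obtain ⟨N, hN, hp⟩ := h.apply_self_pow (gen g j)
    exact ⟨N, hN, by rw [hself, ← Units.val_pow_eq_pow_val, hp, Units.val_one]⟩

end IsMatchedFamily

end

theorem mainTheorem2 {G : Type u} [Group G] [Finite G]
    (hG : Nonempty (commutator G ≃* Multiplicative (ZMod 2))) :
    ∃ (V : Type) (_ : AddCommGroup V) (_ : Module ℂ V) (M : YDModule G V),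
      FiniteDimensional ℂ V ∧ M.IsIndecomposable ∧ FiniteDimensional ℂ M.NicholsAlgebra ∧
      ∃ (H : Type u) (_ : Ring H) (_ : HopfAlgebra ℂ H) (e : M.SmashProduct ≃ₐ[ℂ] H),
        M.IsBosonization e ∧
        FiniteDimensional ℂ H ∧
        IsPointedCoalgebra H ∧
        coradical H = Submodule.span ℂ (Set.range fun g : G => e (M.grp g)) ∧
        IsIndecomposableCoalgebra H ∧
        IsLinkIndecomposable H := by
  obtain ⟨z, hz, hc⟩ := exists_isCommutatorGenerator hG
  obtain ⟨ι, _, g, χ, h⟩ := exists_isMatchedFamily hz hc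
  let M := IsMatchedFamily.ydModule g χ hz
  have hM : M.IsIndecomposable := h.isIndecomposable_ydModule hz
  have hB : FiniteDimensional ℂ M.NicholsAlgebra := h.finiteDimensional_nicholsAlgebra hz
  have hS : FiniteDimensional ℂ M.SmashProduct := inferInstance
  have hL : letI := M.bialgebra; IsLinkIndecomposable M.SmashProduct :=
    M.isLinkIndecomposable_smash hM
  have hI : letI := M.bialgebra; IsIndecomposableCoalgebra M.SmashProduct := by
    let := M.bialgebra
    exact M.hasGroupLikes_smash.isIndecomposableCoalgebra hL
  have hP : letI := M.bialgebra; IsPointedCoalgebra M.SmashProduct := by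
    let := M.bialgebra
    exact M.hasGroupLikes_smash.isPointedCoalgebra
  exact ⟨IsMatchedFamily.Idx g →₀ ℂ, inferInstance, inferInstance, M, inferInstance, hM, hB,
    M.SmashProduct, inferInstance, M.hopfAlgebra, AlgEquiv.refl, M.isBosonization_hopfAlgebra, hS,
    hP, M.coradical_smash, hI, hL⟩
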